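/- Let $n>1$ and let $M$ be a smooth manifold of dimension $2n+1$ with a Riemannian metric $g$, Levi-Civita connection $\nabla$, and curvature $R(X,Y)=[\nabla_X,\nabla_Y]-\nabla_{[X,Y]}$. Let $(\varphi,\xi,\eta,g)$ be an almost contact metric structure on $M$: $\varphi$ is a smooth $(1,1)$-tensor field, $\xi$ a smooth unit vector field, $\eta=g(\cdot,\xi)$, and $$\varphi^2X=-X+\eta(X)\xi,\qquad g(\varphi X,\varphi Y)=g(X,Y)-\eta(X)\eta(Y)$$ for all vector fields $X,Y$. Suppose that it is almost Kenmotsu, that is, $d\eta=0$ and $d\Phi=2\,\eta\wedge\Phi$ where $\Phi(X,Y)=g(X,\varphi Y)$. Put $h=\tfrac12\mathcal L_\xi\varphi$, that is, $hX=\tfrac12\big([\xi,\varphi X]-\varphi[\xi,X]\big)$. Suppose that $M$ is a generalized $(\kappa,\mu)$-almost Kenmotsu manifold: $\kappa,\mu$ are smooth functions on $M$ and $$R(X,Y)\xi=\kappa\,[\eta(Y)X-\eta(X)Y]+\mu\,[\eta(Y)hX-\eta(X)hY]$$ for all vector fields $X,Y$. Suppose finally that $h\neq 0$, i.e. $h$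 does not vanish identically on $M$. Then the critical point equation (CPE) has no solution on $M$: there is no smooth function $\lambda:M\to\mathbb R$, constant or not, such that $$-(\Delta_g\lambda)\,g+\mathrm{Hess}_g\lambda-\lambda\,\mathrm{Ric}_g=\mathrm{Ric}_g-\frac{r}{2n+1}\,g ,$$ where $\Delta_g\lambda$ is the trace of $\mathrm{Hess}_g\lambda$, $\mathrm{Ric}_g(Y,Z)$ is the trace of $X\mapsto R(X,Y)Z$, and $r$ is the scalar curvature of $g$. -/

import Mathlib

open Bundle FiberBundle VectorField
open scoped Manifold ContDiff

noncomputable section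

namespace CPEKenmotsu

set_option linter.unusedSectionVars false

variable {E : Type*} [NormedAddCommGroup E] [NormedSpace ℝ E] [FiniteDimensional ℝ E]
  [CompleteSpace E] {H : Type*} [TopologicalSpace H] {I : ModelWithCorners ℝ E H}
  {M : Type*} [TopologicalSpace M] [ChartedSpace H M] [IsManifold I ∞ M]
  [RiemannianBundle (TangentSpace I : M → Type _)]
  [IsContMDiffRiemannianBundle I ∞ E (TangentSpace I : M → Type _)]

/-! ### The Levi-Civita connection, constructed from the Koszul formula -/

instance tangentSpace_finiteDimensional (x : M) : FiniteDimensional ℝ (TangentSpace I x) :=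
  inferInstanceAs (FiniteDimensional ℝ E)



theorem mdifferentiableAt_inner {x : M} {X Y : Π x : M, TangentSpace I x}
    (hX : MDiffAt (T% X) x) (hY : MDiffAt (T% Y) x) :
    MDifferentiableAt I 𝓘(ℝ, ℝ) (fun y ↦ inner ℝ (X y) (Y y)) x :=
  MDifferentiableAt.inner_bundle (F := E) (E := (TangentSpace I : M → Type _)) (b := fun y : M ↦ y)
    (IB := I) hX hY

variable (I) in
/-- The right-hand side of the Koszul formula for `2 ⟨∇_X Y, Z⟩` at `x`. -/
def koszul (Y X Z : Π x : M, TangentSpace I x) (x : M) : ℝ :=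
  mvfderiv I (fun y ↦ inner ℝ (Y y) (Z y)) x (X x)
  + mvfderiv I (fun y ↦ inner ℝ (X y) (Z y)) x (Y x)
  - mvfderiv I (fun y ↦ inner ℝ (X y) (Y y)) x (Z x)
  + inner ℝ (mlieBracket I X Y x) (Z x)
  - inner ℝ (mlieBracket I X Z x) (Y x)
  - inner ℝ (mlieBracket I Y Z x) (X x)

theorem koszul_tensorial_left {x : M} {Y Z : Π x : M, TangentSpace I x}
    (hY : MDiffAt (T% Y) x) (hZ : MDiffAt (T% Z) x) :
    TensorialAt I E (fun X ↦ koszul I Y X Z x) x where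
  smul {f X} hf hX := by
    have h1 := mvfderiv_fun_mul hf (mdifferentiableAt_inner hX hZ)
    have h2 := mvfderiv_fun_mul hf (mdifferentiableAt_inner hX hY)
    simp [koszul, mlieBracket_smul_left hf hX, inner_add_left, inner_smul_left, inner_smul_right, h1, h2]
    rw [real_inner_comm (X x) (mlieBracket I Y Z x)]
    ring
  add {X X'} hX hX' := by
    simp [koszul, mvfderiv_fun_add (mdifferentiableAt_inner hX hZ) (mdifferentiableAt_inner hX' hZ),
      mvfderiv_fun_add (mdifferentiableAt_inner hX hY) (mdifferentiableAt_inner hX' hY),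
      mlieBracket_add_left hX hX', inner_add_left, inner_add_right]
    ring

theorem koszul_tensorial_right {x : M} {Y X : Π x : M, TangentSpace I x}
    (hY : MDiffAt (T% Y) x) (hX : MDiffAt (T% X) x) :
    TensorialAt I E (fun Z ↦ koszul I Y X Z x) x where
  smul {f Z} hf hZ := by
    have h1 := mvfderiv_fun_mul hf (mdifferentiableAt_inner hX hZ)
    have h2 := mvfderiv_fun_mul hf (mdifferentiableAt_inner hY hZ)
    simp [koszul, mlieBracket_smul_right hf hZ, inner_add_left, inner_smul_left, inner_smul_right, h1, h2]
    rw [real_inner_comm (Z x) (X x), real_inner_comm (Z x) (Y x)]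
    ring
  add {Z Z'} hZ hZ' := by
    simp [koszul, mvfderiv_fun_add (mdifferentiableAt_inner hX hZ) (mdifferentiableAt_inner hX hZ'),
      mvfderiv_fun_add (mdifferentiableAt_inner hY hZ) (mdifferentiableAt_inner hY hZ'),
      mlieBracket_add_right hZ hZ', inner_add_left, inner_add_right]
    ring

open Classical in
variable (I) in
/-- The bilinear form `(v, w) ↦ 2 ⟨∇_v Y, w⟩` on the tangent space at `x`, for `Y` differentiable
at `x` (and zero, a junk value, for other `Y`). -/
def koszulForm (Y : Π x : M, TangentSpace I x) (x : M) :
    TangentSpace I x →L[ℝ] TangentSpace I x →L[ℝ] ℝ :=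
  if hY : MDiffAt (T% Y) x then
    TensorialAt.mkHom₂ (I := I) (F := E) (F' := E) (fun X Z ↦ koszul I Y X Z x) x
      (fun _ hZ ↦ koszul_tensorial_left hY hZ) (fun _ hX ↦ koszul_tensorial_right hY hX)
  else 0

theorem koszulForm_apply {x : M} {X Y Z : Π x : M, TangentSpace I x}
    (hX : MDiffAt (T% X) x) (hY : MDiffAt (T% Y) x) (hZ : MDiffAt (T% Z) x) :
    koszulForm I Y x (X x) (Z x) = koszul I Y X Z x := by
  rw [koszulForm, dif_pos hY]
  exact TensorialAt.mkHom₂_apply (I := I) (F := E) (F' := E) _ _ hX hZ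

variable (I) in
/-- `leviCivitaFun I Y x v` is `∇_v Y` at `x`: half the vector representing `koszulForm I Y x v`. -/
def leviCivitaFun (Y : Π x : M, TangentSpace I x) (x : M) :
    TangentSpace I x →L[ℝ] TangentSpace I x :=
  haveI : CompleteSpace (TangentSpace I x) := FiniteDimensional.complete ℝ _
  LinearMap.toContinuousLinearMap
    { toFun := fun v ↦
        (1 / 2 : ℝ) • (InnerProductSpace.toDual ℝ (TangentSpace I x)).symm (koszulForm I Y x v)
      map_add' := fun v w ↦ by simp
      map_smul' := fun c v ↦ by simp [smul_comm c] }

theorem inner_leviCivitaFun (Y : Π x : M, TangentSpace I x) (x : M) (v w : TangentSpace I x) :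
    inner ℝ (leviCivitaFun I Y x v) w = 1 / 2 * koszulForm I Y x v w := by
  have : CompleteSpace (TangentSpace I x) := FiniteDimensional.complete ℝ _
  simp [leviCivitaFun, inner_smul_left]

theorem inner_leviCivitaFun_eq {x : M} {X Y Z : Π x : M, TangentSpace I x}
    (hX : MDiffAt (T% X) x) (hY : MDiffAt (T% Y) x) (hZ : MDiffAt (T% Z) x) :
    inner ℝ (leviCivitaFun I Y x (X x)) (Z x) = 1 / 2 * koszul I Y X Z x := by
  rw [inner_leviCivitaFun, koszulForm_apply hX hY hZ]

theorem ext_mdiff {x : M} {A B : TangentSpace I x →L[ℝ] TangentSpace I x}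
    (h : ∀ X Z : Π x : M, TangentSpace I x, MDiffAt (T% X) x → MDiffAt (T% Z) x →
      (inner ℝ (A (X x)) (Z x) : ℝ) = inner ℝ (B (X x)) (Z x)) : A = B := by
  ext v
  refine ext_inner_right ℝ fun w ↦ ?_
  simpa using h (extend E v) (extend E w) (mdifferentiableAt_extend ..)
    (mdifferentiableAt_extend ..)

theorem isCovariantDerivativeOn_leviCivitaFun :
    IsCovariantDerivativeOn (I := I) (V := (TangentSpace I : M → Type _)) E
      (leviCivitaFun I) Set.univ where
  add {Y Y' x} hY hY' _ := by
    have hs : MDiffAt (T% (Y + Y')) x := mdifferentiableAt_add_section hY hY'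
    refine ext_mdiff fun X Z hX hZ ↦ ?_
    rw [inner_leviCivitaFun_eq hX hs hZ, _root_.add_apply, inner_add_left,
      inner_leviCivitaFun_eq hX hY hZ, inner_leviCivitaFun_eq hX hY' hZ]
    simp [koszul, mvfderiv_fun_add (mdifferentiableAt_inner hY hZ) (mdifferentiableAt_inner hY' hZ),
      mvfderiv_fun_add (mdifferentiableAt_inner hX hY) (mdifferentiableAt_inner hX hY'),
      mlieBracket_add_left hY hY', mlieBracket_add_right hY hY', inner_add_left, inner_add_right]
    ring
  leibniz {Y f x} hY hf _ := by
    have hs : MDiffAt (T% (f • Y)) x := hf.smul_section hY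
    refine ext_mdiff fun X Z hX hZ ↦ ?_
    rw [inner_leviCivitaFun_eq hX hs hZ]
    have h1 := mvfderiv_fun_mul hf (mdifferentiableAt_inner hY hZ)
    have h2 := mvfderiv_fun_mul hf (mdifferentiableAt_inner hX hY)
    have h3 := inner_leviCivitaFun_eq hX hY hZ
    simp [koszul, mlieBracket_smul_left hf hY, mlieBracket_smul_right hf hY, inner_add_left,
      inner_smul_left, inner_smul_right, h1, h2] at h3 ⊢
    rw [h3, real_inner_comm (X x) (Y x)]
    ring

variable (I M) in
/-- The Levi-Civita connection of the Riemannian metric: `leviCivita I M Y x (X x)` is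
`∇_X Y` at `x`. -/
def leviCivita : CovariantDerivative I E (TangentSpace I : M → Type _) where
  toFun := leviCivitaFun I
  isCovariantDerivativeOnUniv := isCovariantDerivativeOn_leviCivitaFun

theorem leviCivita_torsion : (leviCivita I M).torsion = 0 := by
  rw [CovariantDerivative.torsion_eq_zero_iff]
  intro X Y x hX hY
  refine ext_inner_right ℝ fun w ↦ ?_
  obtain ⟨Z, hZ, hw⟩ : ∃ Z : Π x : M, TangentSpace I x, MDiffAt (T% Z) x ∧ w = Z x :=
    ⟨extend E w, mdifferentiableAt_extend .., by simp⟩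
  have h1 := inner_leviCivitaFun_eq hX hY hZ
  have h2 := inner_leviCivitaFun_eq hY hX hZ
  rw [hw, inner_sub_left]
  simp only [leviCivita]
  rw [h1, h2]
  simp only [koszul, real_inner_comm (X _) (Y _)]
  rw [mlieBracket_swap_apply (V := Y) (W := X)]
  simp only [inner_neg_left]
  ring

theorem leviCivita_metric {x : M} {X Y Z : Π x : M, TangentSpace I x}
    (hX : MDiffAt (T% X) x) (hY : MDiffAt (T% Y) x) (hZ : MDiffAt (T% Z) x) :
    mvfderiv I (fun y ↦ inner ℝ (Y y) (Z y)) x (X x)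
      = inner ℝ (leviCivita I M Y x (X x)) (Z x) + inner ℝ (Y x) (leviCivita I M Z x (X x)) := by
  rw [real_inner_comm _ (Y x)]
  simp only [leviCivita]
  rw [inner_leviCivitaFun_eq hX hY hZ, inner_leviCivitaFun_eq hX hZ hY]
  simp only [koszul, real_inner_comm (Z _) (Y _)]
  rw [mlieBracket_swap_apply (V := Z) (W := Y)]
  simp only [inner_neg_left, real_inner_comm (Z _) (X _), real_inner_comm (Y _) (X _)]
  ring

/-! ### Curvature -/

variable (I) in
/-- A smooth vector field on `M`. -/
def IsSmoothField (X : Π x : M, TangentSpace I x) : Prop :=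
  ContMDiff I I.tangent ∞ (fun x ↦ (⟨x, X x⟩ : TangentBundle I M))

/-- The curvature `R(X, Y) Z = ∇_X ∇_Y Z - ∇_Y ∇_X Z - ∇_{[X, Y]} Z`. -/
def curvature (X Y Z : Π x : M, TangentSpace I x) (x : M) : TangentSpace I x :=
  leviCivita I M (fun y ↦ leviCivita I M Z y (Y y)) x (X x)
  - leviCivita I M (fun y ↦ leviCivita I M Z y (X y)) x (Y x)
  - leviCivita I M Z x (mlieBracket I X Y x)

/-- The Ricci tensor `Ric(v, w) = ∑ i, ⟨R(e i, v) w, e i⟩`, with `e` an orthonormal basis of the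
tangent space at `x`. The curvature, being a tensor, is evaluated on vectors at `x` by extending
them to vector fields which are smooth near `x`. -/
def ricci (x : M) (v w : TangentSpace I x) : ℝ :=
  ∑ i, inner ℝ (curvature (I := I) (extend E (stdOrthonormalBasis ℝ (TangentSpace I x) i))
      (extend E v) (extend E w) x) (stdOrthonormalBasis ℝ (TangentSpace I x) i)

variable (I) in
/-- The scalar curvature. -/
def scalarCurvature (x : M) : ℝ :=
  ∑ i, ricci (I := I) x (stdOrthonormalBasis ℝ (TangentSpace I x) i)
    (stdOrthonormalBasis ℝ (TangentSpace I x) i)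

/-! ### The critical point equation -/

variable (I) in
/-- The gradient of a function. -/
def gradient (f : M → ℝ) (x : M) : TangentSpace I x :=
  haveI : CompleteSpace (TangentSpace I x) := FiniteDimensional.complete ℝ _
  (InnerProductSpace.toDual ℝ (TangentSpace I x)).symm (mvfderiv I f x)

/-- The Hessian `Hess f (v, w) = ⟨∇_v (grad f), w⟩`. -/
def hessian (f : M → ℝ) (x : M) (v w : TangentSpace I x) : ℝ :=
  inner ℝ (leviCivita I M (gradient I f) x v) w

variable (I) in
/-- The Laplacian, as the trace of the Hessian. -/
def laplacian (f : M → ℝ) (x : M) : ℝ :=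
  ∑ i, hessian (I := I) f x (stdOrthonormalBasis ℝ (TangentSpace I x) i)
    (stdOrthonormalBasis ℝ (TangentSpace I x) i)

/-- The formal adjoint of the linearised scalar curvature operator,
`L*(f) = -(Δ f) g + Hess f - f Ric`. -/
def linScalarAdjoint (f : M → ℝ) (x : M) (v w : TangentSpace I x) : ℝ :=
  -(laplacian I f x) * inner ℝ v w + hessian f x v w - f x * ricci x v w

/-- The traceless Ricci tensor `Ric - (r / dim M) g`. -/
def tracelessRicci (x : M) (v w : TangentSpace I x) : ℝ :=
  ricci x v w - scalarCurvature I x / (Module.finrank ℝ E : ℝ) * inner ℝ v w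

variable (I) in
/-- The critical point equation `L*(f) = Ric - (r / dim M) g` for the potential function `f`. -/
def SatisfiesCPE (f : M → ℝ) : Prop :=
  ∀ (x : M) (v w : TangentSpace I x), linScalarAdjoint f x v w = tracelessRicci x v w

/-! ### Almost Kenmotsu manifolds -/

variable (I M) in
/-- An almost contact metric structure `(φ, ξ, η, g)`, where `g` is the given Riemannian metric. -/
structure AlmostContactMetric where
  /-- the tensor field `φ` of type `(1, 1)` -/
  phi : Π x : M, TangentSpace I x →L[ℝ] TangentSpace I x
  /-- the Reeb vector field `ξ` -/
  xi : Π x : M, TangentSpace I x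
  /-- the 1-form `η` -/
  eta : Π x : M, TangentSpace I x →L[ℝ] ℝ
  contMDiff_phi : ContMDiff I (I.prod 𝓘(ℝ, E →L[ℝ] E)) ∞
    (fun x ↦ (⟨x, phi x⟩ :
      TotalSpace (E →L[ℝ] E) (fun x : M ↦ TangentSpace I x →L[ℝ] TangentSpace I x)))
  smooth_xi : IsSmoothField I xi
  eta_eq : ∀ (x : M) (v : TangentSpace I x), eta x v = inner ℝ v (xi x)
  inner_xi_xi : ∀ x : M, inner ℝ (xi x) (xi x) = (1 : ℝ)
  phi_phi : ∀ (x : M) (v : TangentSpace I x), phi x (phi x v) = -v + eta x v • xi x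
  inner_phi_phi : ∀ (x : M) (v w : TangentSpace I x),
    inner ℝ (phi x v) (phi x w) = inner ℝ v w - eta x v * eta x w

namespace AlmostContactMetric

variable (S : AlmostContactMetric I M)

/-- The vector field `φ X`. -/
def phiField (X : Π x : M, TangentSpace I x) (x : M) : TangentSpace I x := S.phi x (X x)

/-- The fundamental 2-form `Φ(v, w) = g(v, φ w)`. -/
def fundForm (x : M) (v w : TangentSpace I x) : ℝ := inner ℝ v (S.phi x w)

/-- `dη(X, Y) = X (η Y) - Y (η X) - η [X, Y]`. -/
def dEta (X Y : Π x : M, TangentSpace I x) (x : M) : ℝ :=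
  mvfderiv I (fun y ↦ S.eta y (Y y)) x (X x)
  - mvfderiv I (fun y ↦ S.eta y (X y)) x (Y x)
  - S.eta x (mlieBracket I X Y x)

/-- `dΦ(X, Y, Z)`, the cyclic sum of `X (Φ(Y, Z)) - Φ([X, Y], Z)`. -/
def dFundForm (X Y Z : Π x : M, TangentSpace I x) (x : M) : ℝ :=
  mvfderiv I (fun y ↦ S.fundForm y (Y y) (Z y)) x (X x)
  + mvfderiv I (fun y ↦ S.fundForm y (Z y) (X y)) x (Y x)
  + mvfderiv I (fun y ↦ S.fundForm y (X y) (Y y)) x (Z x)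
  - S.fundForm x (mlieBracket I X Y x) (Z x)
  - S.fundForm x (mlieBracket I Y Z x) (X x)
  - S.fundForm x (mlieBracket I Z X x) (Y x)

/-- `(η ∧ Φ)(u, v, w)`, the cyclic sum of `η(u) Φ(v, w)`. -/
def etaWedgeFundForm (x : M) (u v w : TangentSpace I x) : ℝ :=
  S.eta x u * S.fundForm x v w + S.eta x v * S.fundForm x w u + S.eta x w * S.fundForm x u v

/-- Almost Kenmotsu: `dη = 0` and `dΦ = 2 η ∧ Φ`. -/
structure IsAlmostKenmotsu : Prop where
  dEta_eq_zero : ∀ X Y : Π x : M, TangentSpace I x, IsSmoothField I X → IsSmoothField I Y →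
    ∀ x : M, S.dEta X Y x = 0
  dFundForm_eq : ∀ X Y Z : Π x : M, TangentSpace I x,
    IsSmoothField I X → IsSmoothField I Y → IsSmoothField I Z →
    ∀ x : M, S.dFundForm X Y Z x = 2 * S.etaWedgeFundForm x (X x) (Y x) (Z x)

/-- The operator `h = (1/2) L_ξ φ` on vector fields: `h X = (1/2) ([ξ, φ X] - φ [ξ, X])`. -/
def h (X : Π x : M, TangentSpace I x) (x : M) : TangentSpace I x :=
  (1 / 2 : ℝ) • (mlieBracket I S.xi (S.phiField X) x - S.phi x (mlieBracket I S.xi X x))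

/-- `h` is not the zero tensor field. -/
def HNeZero : Prop :=
  ∃ X : Π x : M, TangentSpace I x, IsSmoothField I X ∧ ∃ x : M, S.h X x ≠ 0

/-- `ξ` belongs to the generalized `(κ, μ)`-nullity distribution. -/
def InNullityDistribution (κ μ : M → ℝ) : Prop :=
  ∀ X Y : Π x : M, TangentSpace I x, IsSmoothField I X → IsSmoothField I Y → ∀ x : M,
    curvature X Y S.xi x =
      κ x • (S.eta x (Y x) • X x - S.eta x (X x) • Y x)
      + μ x • (S.eta x (Y x) • S.h X x - S.eta x (X x) • S.h Y x)

/-- A generalized `(κ, μ)`-almost Kenmotsu manifold, with smooth functions `κ` and `μ`. -/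
structure IsGeneralizedKappaMu (κ μ : M → ℝ) : Prop where
  almostKenmotsu : S.IsAlmostKenmotsu
  smooth_kappa : ContMDiff I 𝓘(ℝ, ℝ) ∞ κ
  smooth_mu : ContMDiff I 𝓘(ℝ, ℝ) ∞ μ
  nullity : S.InNullityDistribution κ μ

end AlmostContactMetric

end CPEKenmotsu

end

/-!
Write `∇_X ξ = A X = B X + P X`, where `P` is the projection onto the contact distribution `ker
η`, and put `s = -(κ + 1)`. The almost Kenmotsu conditions say that `A` is self-adjoint, that `φ`
is parallel along `ξ`, that `B φ = -φ B` and that `h = φ B`. The nullity condition for the pairs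
`(X, ξ)` contains the identity `B² = s P` (`KappaMuCalculus.B_B`), so that `κ ≤ -1`, and `h`
vanishes exactly where `s` does; for horizontal pairs it is the Codazzi equation for `A`.

*The curvature where `s ≠ 0`.* The Codazzi equation and the derivative of `B² = s P` express the
derivative of `A` along the leaves of `ker η` by that of `s` (`two_g_dA_B`). The symmetry of this
expression is a relation whose trace is `(2 n - 2) ds ∘ B = 0` on `ker η`
(`ContactVectorSpace.eq_zero_of_relation`). Since `n > 1`, the function `s` is constant along the
leaves. Hence `A` is parallel along the leaves, and then so is `φ` (`g_dφ_eq_zero`): `∇φ` has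
vanishing cyclic sums because `dΦ = 2 η ∧ Φ`, it anticommutes with `φ`, and now also with `B`;
these symmetries force it to be zero. The curvature tensor of the leaves commutes with `B` and
`φ`. As these anticommute, it is zero (`eq_zero_of_curvatureLike`). The Gauss equation now gives
the full curvature tensor of `M` (`g_curv`), so that `Ric = 2 B - 2 n A + μ h + 2 n κ η ⊗ η` and
`r = 2 n κ - 4 n²`.

*The critical point equation.* Let `λ` be a solution, and put `u = λ + 1`. The trace of the
equation turns it into `Hess u = u Ric + f g`, where `f` is a combination of `r λ` and `r`. The
condition that the second derivatives of the function `ξ u` commute gives `u μ = 0` on horizontal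
fields. Suppose that `u ≠ 0` and `s ≠ 0` at some point. Then `μ = 0` nearby, the mixed part of the
same condition shows that `grad u` is a multiple of `ξ`, and the horizontal part of the Hessian
gives `ξ u = -2 (n - 1) u`. Differentiating once more along `ξ` yields `u (4 (n - 1)² - 2 - 2 n κ)
= 0` (`u_mul_eq_zero`), which is impossible for `κ ≤ -1` and `n > 1`. Therefore `λ = -1` wherever
`h ≠ 0`, and there the equation says that `r = 0`, contrary to `r = 2 n κ - 4 n² < 0`.

These are computations with vector fields and functions, in which `s` and `u` have to be divided
by. They are carried out in a `RiemannianCalculus`, an algebraic structure over an arbitrary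
commutative `ℝ`-algebra, and are applied to the smooth functions and vector fields on the open
sets where `s`, and then also `u`, has no zero. The traces are taken in the tangent spaces
(`ContactVectorSpace`).
-/

noncomputable section

namespace CPEKenmotsu

/-! ### Riemannian calculus over a commutative ring -/

/-- The algebraic skeleton of Riemannian geometry: a ring `R` of functions, an `R`-module `V` of
vector fields acting on `R` by derivations, a nondegenerate symmetric form `g`, and a metric
connection `nab` whose bracket `nab X Y - nab Y X` satisfies the Jacobi identity. -/
structure RiemannianCalculus (R V : Type*) [CommRing R] [Algebra ℝ R] [AddCommGroup V]
    [Module R V] where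
  /-- the derivative of a function along a vector field -/
  D : V →ₗ[R] Derivation ℝ R R
  /-- the metric -/
  g : V →ₗ[R] V →ₗ[R] R
  /-- the connection: `nab X Y` is `∇_X Y` -/
  nab : V →ₗ[R] V →+ V
  g_symm : ∀ X Y, g X Y = g Y X
  g_ext : ∀ X Y, (∀ Z, g X Z = g Y Z) → X = Y
  nab_smul : ∀ X Y (f : R), nab X (f • Y) = D X f • Y + f • nab X Y
  metric : ∀ X Y Z, D X (g Y Z) = g (nab X Y) Z + g Y (nab X Z)
  jacobi : ∀ X Y Z, nab X (nab Y Z - nab Z Y) - nab (nab Y Z - nab Z Y) X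
    = nab (nab X Y - nab Y X) Z - nab Z (nab X Y - nab Y X)
      + (nab Y (nab X Z - nab Z X) - nab (nab X Z - nab Z X) Y)

section

variable {R V : Type*} [CommRing R] [Algebra ℝ R] [AddCommGroup V] [Module R V]

theorem eq_of_two_mul_eq {a b : R} (h : 2 * a = 2 * b) : a = b := by
  have h2 : IsUnit (2 : R) := by
    have := (IsUnit.mk0 (2 : ℝ) two_ne_zero).map (algebraMap ℝ R)
    rwa [map_ofNat] at this
  exact h2.mul_left_cancel h

namespace RiemannianCalculus

variable (C : RiemannianCalculus R V)

/-- The bracket of vector fields. -/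
def br (X Y : V) : V := C.nab X Y - C.nab Y X

/-- The curvature `R(X, Y) Z = ∇_X ∇_Y Z - ∇_Y ∇_X Z - ∇_{[X, Y]} Z`. -/
def curv (X Y Z : V) : V :=
  C.nab X (C.nab Y Z) - C.nab Y (C.nab X Z) - C.nab (C.br X Y) Z

/-- The bracket acts on functions as the commutator: the Jacobi identity for `X`, `Y`, `f • Z`
gives this for a unit field `Z`. -/
theorem D_br {Z : V} (hZ : C.g Z Z = 1) (X Y : V) (f : R) :
    C.D (C.br X Y) f = C.D X (C.D Y f) - C.D Y (C.D X f) := by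
  have h1 := C.jacobi X Y (f • Z)
  have h2 := C.jacobi X Y Z
  simp only [C.nab_smul, map_smul, map_add, map_sub, AddMonoidHom.smul_apply,
    AddMonoidHom.sub_apply, AddMonoidHom.add_apply] at h1 h2
  have h3 : (C.D (C.br X Y) f - (C.D X (C.D Y f) - C.D Y (C.D X f))) • Z = 0 := by
    simp only [br, map_sub, Derivation.sub_apply]
    linear_combination (norm := module) f • h2 - h1
  have h4 := congrArg (fun W ↦ C.g W Z) h3
  simp only [map_smul, LinearMap.smul_apply, hZ, map_zero, LinearMap.zero_apply] at h4
  linear_combination h4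

theorem curv_swap (X Y Z : V) : C.curv X Y Z = -C.curv Y X Z := by
  simp only [curv, br, map_sub, AddMonoidHom.sub_apply]
  abel

theorem bianchi (X Y Z : V) : C.curv X Y Z + C.curv Y Z X + C.curv Z X Y = 0 := by
  have h := C.jacobi X Y Z
  simp only [curv, br, map_sub, AddMonoidHom.sub_apply] at h ⊢
  linear_combination (norm := module) h

/-- The curvature is skew in its last two arguments, as `∇` is metric and the bracket acts on
functions as the commutator. -/
theorem curv_skew {E : V} (hE : C.g E E = 1) (X Y Z W : V) :
    C.g (C.curv X Y Z) W = -C.g (C.curv X Y W) Z := by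
  have h := C.D_br hE X Y (C.g Z W)
  simp only [C.metric, map_add] at h
  simp only [curv, map_sub, LinearMap.sub_apply]
  linear_combination -h + C.g_symm (C.nab X (C.nab Y W)) Z - C.g_symm (C.nab Y (C.nab X W)) Z
    - C.g_symm (C.nab (C.br X Y) W) Z

end RiemannianCalculus

/-- The pair symmetry of a function with the symmetries of a curvature tensor. -/
theorem pair_symm_of_bianchi {ι : Type*} {F : ι → ι → ι → ι → R}
    (h12 : ∀ x y z w, F x y z w = -F y x z w) (h34 : ∀ x y z w, F x y z w = -F x y w z)
    (hb : ∀ x y z w, F x y z w + F y z x w + F z x y w = 0) (x y z w : ι) :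
    F x y z w = F z w x y := by
  apply eq_of_two_mul_eq
  linear_combination hb x y z w + hb y z w x - hb z w x y - hb w x y z
    - h34 y z w x - h34 z w y x - h12 w y z x + h34 y w z x + h12 x z w y - h34 z x w y
    + h34 w x y z + h34 x y w z

/-! ### Almost Kenmotsu calculus -/

/-- A Riemannian calculus with a generalized `(κ, μ)`-almost Kenmotsu structure. -/
structure KappaMuCalculus (R V : Type*) [CommRing R] [Algebra ℝ R] [AddCommGroup V]
    [Module R V] extends RiemannianCalculus R V where
  /-- the structure tensor -/
  φ : V →ₗ[R] V
  /-- the Reeb field -/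
  ξ : V
  /-- the operator `(1/2) L_ξ φ` -/
  h : V → V
  /-- the first coefficient of the nullity condition -/
  κ : R
  /-- the second coefficient of the nullity condition -/
  μ : R
  g_ξ_ξ : g ξ ξ = 1
  φ_φ : ∀ X, φ (φ X) = -X + g X ξ • ξ
  g_φ_φ : ∀ X Y, g (φ X) (φ Y) = g X Y - g X ξ * g Y ξ
  φ_ξ : φ ξ = 0
  dEta : ∀ X Y, D X (g Y ξ) - D Y (g X ξ) - g (nab X Y - nab Y X) ξ = 0
  dFundForm : ∀ X Y Z, D X (g Y (φ Z)) + D Y (g Z (φ X)) + D Z (g X (φ Y))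
    - g (nab X Y - nab Y X) (φ Z) - g (nab Y Z - nab Z Y) (φ X) - g (nab Z X - nab X Z) (φ Y)
    = 2 * (g X ξ * g Y (φ Z) + g Y ξ * g Z (φ X) + g Z ξ * g X (φ Y))
  two_h : ∀ X, (2 : R) • h X
    = nab ξ (φ X) - nab (φ X) ξ - φ (nab ξ X - nab X ξ)
  nullity : ∀ X Y, toRiemannianCalculus.curv X Y ξ
    = κ • (g Y ξ • X - g X ξ • Y) + μ • (g Y ξ • h X - g X ξ • h Y)

namespace KappaMuCalculus

variable (S : KappaMuCalculus R V)

theorem eq_of_two_smul_eq (S : KappaMuCalculus R V) {X Y : V}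
    (h : (2 : R) • X = (2 : R) • Y) : X = Y := by
  refine S.g_ext _ _ fun Z ↦ eq_of_two_mul_eq ?_
  simpa using congrArg (fun W ↦ S.g W Z) h

theorem g_φ_ξ (X : V) : S.g (S.φ X) S.ξ = 0 := by
  have h1 := congrArg S.φ (S.φ_φ X)
  rw [S.φ_φ] at h1
  have h4 : S.g (S.φ X) S.ξ • S.ξ = 0 := by
    simp only [map_add, map_neg, map_smul, S.φ_ξ, smul_zero] at h1
    linear_combination (norm := module) h1
  simpa [S.g_ξ_ξ] using congrArg (fun W ↦ S.g W S.ξ) h4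

theorem g_φ_left (X Y : V) : S.g (S.φ X) Y = -S.g X (S.φ Y) := by
  have h := S.g_φ_φ X (S.φ Y)
  rw [S.φ_φ Y, S.g_φ_ξ] at h
  simp only [map_add, map_neg, map_smul, S.g_φ_ξ, smul_eq_mul] at h
  linear_combination -h

/-- The shape operator `A X = ∇_X ξ`. -/
def A : V →ₗ[R] V where
  toFun X := S.nab X S.ξ
  map_add' X Y := by simp
  map_smul' f X := by simp

/-- The projection onto the contact distribution `ker η`. -/
def P : V →ₗ[R] V where
  toFun X := X - S.g X S.ξ • S.ξ
  map_add' X Y := by simp only [map_add, LinearMap.add_apply]; module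
  map_smul' f X := by
    simp only [map_smul, LinearMap.smul_apply, smul_eq_mul, RingHom.id_apply]; module

/-- The trace-free part `B = A - P` of the shape operator. -/
def B : V →ₗ[R] V := S.A - S.P

/-- The function `s = -(κ + 1)`; the square of `B` is `s` times the projection. -/
def s : R := -(S.κ + 1)

theorem A_def (X : V) : S.nab X S.ξ = S.A X := rfl
theorem P_def (X : V) : S.P X = X - S.g X S.ξ • S.ξ := rfl
theorem B_def (X : V) : S.B X = S.A X - S.P X := rfl

theorem g_A_ξ (X : V) : S.g (S.A X) S.ξ = 0 := by
  have h := S.metric X S.ξ S.ξ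
  rw [S.g_ξ_ξ, Derivation.map_one_eq_zero, A_def, S.g_symm S.ξ] at h
  apply eq_of_two_mul_eq
  linear_combination -h

theorem g_A_left (X Y : V) : S.g (S.A X) Y = S.g X (S.A Y) := by
  have h := S.dEta X Y
  simp only [S.metric, map_sub, LinearMap.sub_apply, A_def] at h
  linear_combination h - S.g_symm Y (S.A X)

theorem A_ξ : S.A S.ξ = 0 := by
  refine S.g_ext _ _ fun Z ↦ ?_
  rw [g_A_left, S.g_symm, g_A_ξ, map_zero, LinearMap.zero_apply]

theorem P_ξ : S.P S.ξ = 0 := by simp [P_def, S.g_ξ_ξ]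
theorem B_ξ : S.B S.ξ = 0 := by simp [B_def, A_ξ, P_ξ]

theorem g_P_ξ (X : V) : S.g (S.P X) S.ξ = 0 := by simp [P_def, S.g_ξ_ξ]
theorem g_B_ξ (X : V) : S.g (S.B X) S.ξ = 0 := by simp [B_def, g_A_ξ, g_P_ξ]

theorem P_of_horizontal {X : V} (hX : S.g X S.ξ = 0) : S.P X = X := by simp [P_def, hX]

theorem B_of_horizontal {X : V} (hX : S.g X S.ξ = 0) : S.B X = S.A X - X := by
  rw [B_def, P_of_horizontal S hX]

theorem g_P_left (X Y : V) : S.g (S.P X) Y = S.g X (S.P Y) := by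
  simp only [P_def, map_sub, map_smul, LinearMap.sub_apply, LinearMap.smul_apply, smul_eq_mul]
  rw [S.g_symm S.ξ Y]; ring

theorem g_B_left (X Y : V) : S.g (S.B X) Y = S.g X (S.B Y) := by
  simp only [B_def, map_sub, LinearMap.sub_apply, g_A_left, g_P_left]

theorem φ_P (X : V) : S.φ (S.P X) = S.φ X := by simp [P_def, S.φ_ξ]
theorem P_φ (X : V) : S.P (S.φ X) = S.φ X := by simp [P_def, g_φ_ξ]
theorem φ_φ_eq_neg_P (X : V) : S.φ (S.φ X) = -S.P X := by rw [S.φ_φ, P_def]; module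

/-- Two fields that have the same products with `ξ` and with all horizontal fields are equal. -/
theorem ext_horizontal {X Y : V} (h0 : S.g X S.ξ = S.g Y S.ξ)
    (h : ∀ Z, S.g Z S.ξ = 0 → S.g X Z = S.g Y Z) : X = Y := by
  refine S.g_ext _ _ fun Z ↦ ?_
  have h1 := h (S.P Z) (S.g_P_ξ Z)
  simp only [P_def, map_sub, map_smul, smul_eq_mul] at h1
  linear_combination h1 + S.g Z S.ξ * h0

/-! ### The structure tensor is parallel along the Reeb field -/

/-- The covariant derivative `(∇_X φ) Y`. -/
def dφ (X Y : V) : V := S.nab X (S.φ Y) - S.φ (S.nab X Y)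

/-- The covariant derivative `(∇_X A) Y`. -/
def dA (X Y : V) : V := S.nab X (S.A Y) - S.A (S.nab X Y)

/-- The covariant derivative of `φ` is skew, as `φ` is. -/
theorem g_dφ (X Y Z : V) : S.g Y (S.dφ X Z) = -S.g (S.dφ X Y) Z := by
  have h := S.metric X Y (S.φ Z)
  have h' := S.metric X (S.φ Y) Z
  rw [g_φ_left, map_neg] at h'
  simp only [dφ, map_sub, LinearMap.sub_apply]
  linear_combination -h - h' - S.g_φ_left (S.nab X Y) Z - S.g_φ_left Y (S.nab X Z)

/-- The covariant derivative of `A` is self-adjoint, as `A` is. -/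
theorem g_dA (X Y Z : V) : S.g (S.dA X Y) Z = S.g (S.dA X Z) Y := by
  have h := S.metric X Y (S.A Z)
  have h' := S.metric X (S.A Y) Z
  rw [g_A_left] at h'
  simp only [dA, map_sub, LinearMap.sub_apply]
  linear_combination h - h' - S.g_A_left (S.nab X Y) Z - S.g_A_left Y (S.nab X Z)
    + S.g_symm Y (S.nab X (S.A Z)) - S.g_symm Y (S.A (S.nab X Z))

/-- The equation `dΦ = 2 η ∧ Φ`, in terms of the covariant derivative of `φ`. -/
theorem dφ_cyclic (X Y Z : V) :
    S.g Y (S.dφ X Z) + S.g Z (S.dφ Y X) + S.g X (S.dφ Z Y)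
      = 2 * (S.g X S.ξ * S.g Y (S.φ Z) + S.g Y S.ξ * S.g Z (S.φ X)
        + S.g Z S.ξ * S.g X (S.φ Y)) := by
  rw [← S.dFundForm]
  simp only [S.metric, dφ, map_sub, LinearMap.sub_apply]
  linear_combination -S.g_φ_left Y (S.nab X Z) - S.g_φ_left Z (S.nab Y X)
    - S.g_φ_left X (S.nab Z Y) - S.g_symm (S.nab X Z) (S.φ Y) - S.g_symm (S.nab Y X) (S.φ Z)
    - S.g_symm (S.nab Z Y) (S.φ X)

theorem dφ_ξ (X : V) : S.dφ X S.ξ = -S.φ (S.A X) := by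
  simp [dφ, S.φ_ξ, A_def]

/-- The derivative of the identity for `φ²`. -/
theorem dφ_φ (X Z : V) : S.dφ X (S.φ Z) + S.φ (S.dφ X Z)
    = S.g (S.A X) Z • S.ξ + S.g Z S.ξ • S.A X := by
  have h := S.metric X Z S.ξ
  simp only [dφ, map_sub, S.φ_φ, map_add, map_neg, S.nab_smul, h, A_def]
  rw [S.g_symm Z (S.A X)]
  module

/-- The equation `dΦ = 2 η ∧ Φ` with `ξ` in one slot. -/
theorem dφ_ξ_left (Z : V) : S.dφ S.ξ Z + S.A (S.φ Z) + S.φ (S.A Z) = (2 : R) • S.φ Z := by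
  refine S.g_ext _ _ fun Y ↦ ?_
  have h := S.dφ_cyclic S.ξ Y Z
  have h1 := S.g_dφ Z S.ξ Y
  rw [S.dφ_ξ] at h h1
  simp only [map_neg, LinearMap.neg_apply, S.g_ξ_ξ, S.φ_ξ, map_zero, map_add, map_smul,
    LinearMap.add_apply, LinearMap.smul_apply, smul_eq_mul] at h h1 ⊢
  rw [S.g_symm S.ξ (S.φ Y), S.g_φ_ξ] at h
  linear_combination h - h1 + S.g_symm (S.dφ S.ξ Z) Y + S.g_A_left (S.φ Z) Y
    + S.g_φ_left Z (S.A Y) + 2 * S.g_symm Y (S.φ Z)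

theorem A_φ_φ (Z : V) : S.A (S.φ (S.φ Z)) = -S.A Z := by
  rw [S.φ_φ]; simp [A_ξ]

theorem φ_φ_A (Z : V) : S.φ (S.φ (S.A Z)) = -S.A Z := by
  rw [S.φ_φ]; simp [g_A_ξ]

/-- Of the two sides of `dφ_ξ_left`, `∇_ξ φ` anticommutes with `φ` and the rest commutes with it. -/
theorem dφ_ξ_left_eq_zero (Z : V) : S.dφ S.ξ Z = 0 := by
  have h := S.dφ_φ S.ξ Z
  have e1 := S.dφ_ξ_left (S.φ Z)
  have e2 := congrArg S.φ (S.dφ_ξ_left Z)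
  rw [A_φ_φ] at e1
  simp only [A_ξ, map_zero, LinearMap.zero_apply, zero_smul, smul_zero, map_add, φ_φ_A,
    map_smul] at h e2
  have h3 : S.φ (S.dφ S.ξ Z) = 0 := by
    apply S.eq_of_two_smul_eq
    linear_combination (norm := module) h + e2 - e1
  have h4 := S.φ_φ (S.dφ S.ξ Z)
  have h5 := S.g_dφ S.ξ S.ξ Z
  rw [dφ_ξ, A_ξ, map_zero, neg_zero, map_zero, LinearMap.zero_apply, neg_zero, S.g_symm] at h5
  rw [h3, h5, map_zero, zero_smul, add_zero] at h4
  exact neg_eq_zero.mp h4.symm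

theorem A_φ (Z : V) : S.A (S.φ Z) = (2 : R) • S.φ Z - S.φ (S.A Z) := by
  have h := S.dφ_ξ_left Z
  rw [dφ_ξ_left_eq_zero] at h
  linear_combination (norm := module) h

/-- The trace-free part of the shape operator anticommutes with `φ`. -/
theorem B_φ (Z : V) : S.B (S.φ Z) = -S.φ (S.B Z) := by
  simp only [B_def, A_φ, P_φ, map_sub, φ_P]; module

/-- The operator `h` is `φ B`, because `∇_ξ φ = 0`. -/
theorem h_eq (X : V) : S.h X = S.φ (S.B X) := by
  apply S.eq_of_two_smul_eq
  have h := S.dφ_ξ_left_eq_zero X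
  rw [S.two_h]
  simp only [dφ, map_sub, A_def, B_def, φ_P, A_φ] at h ⊢
  linear_combination (norm := module) h

/-! ### Consequences of the nullity condition -/

/-- The Codazzi expression for `R(X, Y) ξ`. -/
theorem curv_ξ (X Y : V) : S.curv X Y S.ξ = S.dA X Y - S.dA Y X := by
  simp only [RiemannianCalculus.curv, RiemannianCalculus.br, dA, A_def, map_sub,
    AddMonoidHom.sub_apply]
  abel

/-- The bilinear form `⟨R(X, ξ) ξ, Y⟩`. -/
def m (X Y : V) : R := S.κ * S.g (S.P X) Y + S.μ * S.g (S.φ (S.B X)) Y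

/-- The nullity condition for the pair `(X, ξ)`, a Riccati equation for `A` along `ξ`. -/
theorem dA_ξ_left (X : V) :
    S.dA S.ξ X + S.A (S.A X) + S.κ • S.P X + S.μ • S.φ (S.B X) = 0 := by
  have h := S.nullity X S.ξ
  rw [curv_ξ, S.h_eq, S.h_eq, B_ξ, map_zero, smul_zero, S.g_ξ_ξ] at h
  have h1 : S.dA X S.ξ = -S.A (S.A X) := by simp [dA, A_ξ, A_def]
  rw [h1] at h
  rw [P_def]
  linear_combination (norm := module) -h

/-- Along `ξ` the derivative of `A` anticommutes with `φ`, as `B = A - P` anticommutes with `φ` and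
`φ` is parallel along `ξ`. -/
theorem φ_dA_ξ_left_φ (X : V) : S.φ (S.dA S.ξ (S.φ X)) = S.dA S.ξ X := by
  have h1 := S.dφ_ξ_left_eq_zero X
  have h2 := S.dφ_ξ_left_eq_zero (S.A X)
  have h3 : S.g (S.dA S.ξ X) S.ξ = 0 := by
    rw [g_dA]; simp [dA, A_ξ, A_def]
  have h4 := S.φ_φ (S.dA S.ξ X)
  rw [h3, zero_smul, add_zero] at h4
  have h5 : S.dA S.ξ (S.φ X) = -S.φ (S.dA S.ξ X) := by
    have h6 : S.nab S.ξ ((2 : R) • S.φ X) = (2 : R) • S.nab S.ξ (S.φ X) := by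
      simp [two_smul]
    have h7 := congrArg S.A (sub_eq_zero.mp h1)
    rw [A_φ] at h7
    simp only [dφ, dA, A_φ, map_sub, h6] at h1 h2 ⊢
    rw [h7]
    linear_combination (norm := module) (2 : R) • h1 - h2
  rw [h5, map_neg, h4, neg_neg]

/-- The part of `dA_ξ_left` that commutes with `φ`; it says that the square of `A - P` is `s P`. -/
theorem A_A (X : V) : S.A (S.A X) = (2 : R) • S.A X + (S.s - 1) • S.P X := by
  have h1 := S.dA_ξ_left X
  have h2 := congrArg S.φ (S.dA_ξ_left (S.φ X))
  simp only [map_add, φ_dA_ξ_left_φ, map_smul, P_φ, map_zero, A_φ, map_sub, φ_φ_A, B_φ,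
    map_neg] at h2
  rw [S.φ_φ_eq_neg_P (S.φ (S.B X)), P_φ, S.φ_φ_eq_neg_P X] at h2
  apply S.eq_of_two_smul_eq
  rw [s]
  linear_combination (norm := module) h1 - h2

theorem B_B (X : V) : S.B (S.B X) = S.s • S.P X := by
  have h : S.A (S.P X) = S.A X := by simp [P_def, A_ξ]
  have h' : S.P (S.A X) = S.A X := S.P_of_horizontal (S.g_A_ξ X)
  have h'' : S.P (S.P X) = S.P X := S.P_of_horizontal (S.g_P_ξ X)
  simp only [B_def, map_sub, A_A, h, h', h'']
  module

/-- The Codazzi equation on the leaves of `ker η`. -/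
theorem dA_comm {X Y : V} (hX : S.g X S.ξ = 0) (hY : S.g Y S.ξ = 0) :
    S.dA X Y = S.dA Y X := by
  have h := S.nullity X Y
  rw [curv_ξ, hX, hY] at h
  simp only [zero_smul, sub_zero, smul_zero, add_zero] at h
  exact sub_eq_zero.mp h

/-- The horizontal derivative of `B² = s P`. -/
theorem g_dA_B_add {X Y Z : V} (hY : S.g Y S.ξ = 0) (hZ : S.g Z S.ξ = 0) :
    S.g (S.dA X (S.B Y)) Z + S.g (S.dA X Y) (S.B Z) = S.D X S.s * S.g Y Z := by
  have h := congrArg (fun W ↦ S.g (S.nab X W) Z) (S.A_A Y)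
  have h1 := congrArg (fun W ↦ S.g W Z) (S.A_A (S.nab X Y))
  have h2 := S.P_of_horizontal hY
  have h3 : S.D X 2 = 0 := by simpa using (S.D X).map_natCast 2
  have h4 := S.g_A_left (S.nab X (S.A Y)) Z
  have h5 := S.g_A_left (S.A (S.nab X Y)) Z
  have h6 : S.g S.ξ Z = 0 := by rw [S.g_symm, hZ]
  simp only [P_def, hY, zero_smul, sub_zero, map_add, S.nab_smul, h3, map_sub, map_smul,
    Derivation.map_one_eq_zero, LinearMap.add_apply, LinearMap.smul_apply, LinearMap.sub_apply,
    smul_eq_mul, h6, zero_smul, map_zero,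
    LinearMap.zero_apply] at h h1
  simp only [dA, S.B_of_horizontal hY, S.B_of_horizontal hZ, map_sub, LinearMap.sub_apply]
  linear_combination h - h1 - h4 + h5

/-- The covariant derivative of the shape operator of the leaves, in terms of the derivative of
`s`: the Codazzi equation makes it totally symmetric, and it is determined by the derivative of
`B² = s P`. -/
theorem two_g_dA_B {X Y Z : V} (hX : S.g X S.ξ = 0) (hY : S.g Y S.ξ = 0) (hZ : S.g Z S.ξ = 0) :
    2 * S.g (S.dA (S.B X) Y) Z
      = S.D Y S.s * S.g X Z + S.D Z S.s * S.g X Y - S.D X S.s * S.g Y Z := by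
  have h1 := S.g_dA_B_add (X := X) hY hZ
  have h2 := S.g_dA_B_add (X := Y) hX hZ
  have h3 := S.g_dA_B_add (X := Z) hX hY
  rw [S.g_dA X Y (S.B Z), S.dA_comm hX (S.g_B_ξ Z), S.g_dA _ X Y] at h1
  rw [S.g_dA Y X (S.B Z), S.dA_comm hY (S.g_B_ξ Z), S.dA_comm hY (S.g_B_ξ X)] at h2
  rw [S.dA_comm hZ (S.g_B_ξ X), S.g_dA _ Z Y, S.g_dA Z X, S.dA_comm hZ (S.g_B_ξ Y),
    S.g_dA _ Z X] at h3
  rw [S.dA_comm hX (S.g_B_ξ Y)] at h1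
  linear_combination h2 + h3 - h1

/-- The field `(∇_{B X} A) (B Y)` is symmetric in `X` and `Y`; by `two_g_dA_B`, this constrains the
derivative of `s`. -/
theorem D_s_relation {X Y Z : V} (hX : S.g X S.ξ = 0) (hY : S.g Y S.ξ = 0)
    (hZ : S.g Z S.ξ = 0) :
    S.D (S.B Y) S.s * S.g X Z - S.D X S.s * S.g (S.B Y) Z
      = S.D (S.B X) S.s * S.g Y Z - S.D Y S.s * S.g (S.B X) Z := by
  have h1 := S.two_g_dA_B hX (S.g_B_ξ Y) hZ
  have h2 := S.two_g_dA_B hY (S.g_B_ξ X) hZ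
  rw [S.dA_comm (S.g_B_ξ X) (S.g_B_ξ Y)] at h1
  linear_combination h2 - h1 - S.D Z S.s * (S.g_B_left Y X + S.g_symm X (S.B Y))

/-- If `s` is invertible and constant along `ker η`, the shape operator of the leaves is
parallel. -/
theorem g_dA_eq_zero (hs : IsUnit S.s) (hds : ∀ X, S.g X S.ξ = 0 → S.D X S.s = 0) {X Y Z : V}
    (hX : S.g X S.ξ = 0) (hY : S.g Y S.ξ = 0) (hZ : S.g Z S.ξ = 0) :
    S.g (S.dA X Y) Z = 0 := by
  have h := S.two_g_dA_B (S.g_B_ξ X) hY hZ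
  rw [hds _ hY, hds _ hZ, hds _ (S.g_B_ξ X), B_B, S.P_of_horizontal hX] at h
  have h1 : S.dA (S.s • X) Y = S.s • S.dA X Y := by simp [dA, smul_sub]
  rw [h1, map_smul, LinearMap.smul_apply, smul_eq_mul] at h
  apply hs.mul_left_cancel
  apply eq_of_two_mul_eq
  linear_combination h

/-! ### The leaves of the contact distribution are Kähler -/

/-- The polarised form of: a tensor that is skew in the last two slots, changes sign when `b` is
moved between them, does not when `f` is, and has vanishing cyclic sum, is zero. -/
theorem eq_zero_of_cyclic {ι : Type*} {b f : ι → ι} {s : R} (hs : IsUnit s)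
    {a : ι → ι → ι → R} (hskew : ∀ x y z, a x y z = -a x z y)
    (hb : ∀ x y z, a x (b y) z = -a x y (b z)) (hf : ∀ x y z, a x (f y) z = a x y (f z))
    (hbb : ∀ x y z, a x (b (b y)) z = s * a x y z)
    (hbf : ∀ x y z, a x y (b (f z)) = -a x y (f (b z)))
    (hff : ∀ x y z, a x y (f (f z)) = -a x y z)
    (hcyc : ∀ x y z, a x y z + a y z x + a z x y = 0) (x y z : ι) : a x y z = 0 := by
  -- Write `c x y z = s * a x y z + a (b x) (b y) z`. The cyclic sums make it symmetric in `x` and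
  -- `y`, while `c x y (f w)` is skew in `y` and `w`; a function with both symmetries is zero.
  have hsymm : ∀ x y z, s * a x y z + a (b x) (b y) z = s * a y x z + a (b y) (b x) z := by
    intro x y z
    linear_combination s * hcyc x y z + hcyc (b x) (b y) z - s * hskew y z x - hskew (b y) z (b x)
      - hb z (b x) y + hbb z x y
  have hd : ∀ x y w, s * a x y (f w) + a (b x) (b y) (f w)
      = -(s * a x w (f y) + a (b x) (b w) (f y)) := by
    intro x y w
    linear_combination -s * hf x y w + s * hskew x (f y) w + hb (b x) y (f w) - hbf (b x) y w
      - hf (b x) y (b w) + hskew (b x) (f y) (b w)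
  have h0 : ∀ x y w, s * a x y (f w) + a (b x) (b y) (f w) = 0 := by
    intro x y w
    apply eq_of_two_mul_eq
    linear_combination hd x y w
      - hsymm x w (f y) - hd w x y + hsymm w y (f x) + hd y w x - hsymm y x (f w)
  have h1 : ∀ x y z, s * a x y z + a (b x) (b y) z = 0 := by
    intro x y z
    have := h0 x y (f z)
    rw [hff, hff] at this
    linear_combination -this
  -- in `c x y z = 0` and `c x z y = 0` the second terms are equal, the first terms opposite
  apply hs.mul_left_cancel
  apply eq_of_two_mul_eq
  linear_combination h1 x y z - h1 x z y - hb (b x) y z + s * hskew x y z + hskew (b x) (b z) y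

theorem dφ_neg (X Z : V) : S.dφ X (-Z) = -S.dφ X Z := by
  simp only [dφ, map_neg]; abel

/-- On horizontal fields, `∇φ` anticommutes with `φ`. -/
theorem g_φ_dφ {X Y Z : V} (hY : S.g Y S.ξ = 0) (hZ : S.g Z S.ξ = 0) :
    S.g (S.φ Y) (S.dφ X Z) = S.g Y (S.dφ X (S.φ Z)) := by
  have h := congrArg (S.g Y) (S.dφ_φ X Z)
  rw [hZ, zero_smul, add_zero, map_add, map_smul, hY, smul_zero] at h
  rw [g_φ_left]
  linear_combination -h

/-- If the shape operator of the leaves is parallel, then the derivative of `B φ = -φ B` says that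
`∇φ` anticommutes with `B`. -/
theorem g_B_dφ {X Y Z : V}
    (hdA : ∀ {X Y Z : V}, S.g X S.ξ = 0 → S.g Y S.ξ = 0 → S.g Z S.ξ = 0 → S.g (S.dA X Y) Z = 0)
    (hX : S.g X S.ξ = 0) (hY : S.g Y S.ξ = 0) (hZ : S.g Z S.ξ = 0) :
    S.g (S.B Y) (S.dφ X Z) = -S.g Y (S.dφ X (S.B Z)) := by
  have h1 : S.dA X (S.φ Z) + S.A (S.dφ X Z)
      = (2 : R) • S.dφ X Z - S.dφ X (S.A Z) - S.φ (S.dA X Z) := by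
    have h2 : S.nab X ((2 : R) • S.φ Z) = (2 : R) • S.nab X (S.φ Z) := by simp [two_smul]
    have h3 := S.A_φ (S.nab X Z)
    simp only [dA, dφ, S.A_φ Z, map_sub, h2, h3]
    module
  have h2 := congrArg (S.g Y) h1
  have h3 := hdA hX (S.g_φ_ξ Z) hY
  have h4 := hdA hX hZ (S.g_φ_ξ Y)
  have h5 : S.dφ X (S.A Z - Z) = S.dφ X (S.A Z) - S.dφ X Z := by
    simp only [dφ, map_sub]; abel
  rw [S.B_of_horizontal hY, S.B_of_horizontal hZ, h5]
  rw [S.g_symm] at h3 h4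
  rw [g_φ_left] at h4
  simp only [map_add, map_sub, map_smul, smul_eq_mul, LinearMap.sub_apply, g_A_left] at h2 ⊢
  linear_combination h2 - h3 + h4

/-- The leaves of `ker η` are Kähler: `φ` is parallel along them. -/
theorem g_dφ_eq_zero (hs : IsUnit S.s) (hds : ∀ X, S.g X S.ξ = 0 → S.D X S.s = 0) {X Y Z : V}
    (hX : S.g X S.ξ = 0) (hY : S.g Y S.ξ = 0) (hZ : S.g Z S.ξ = 0) :
    S.g Y (S.dφ X Z) = 0 := by
  let ι := {X : V // S.g X S.ξ = 0}
  refine eq_zero_of_cyclic (ι := ι) (b := fun X ↦ ⟨S.B X.1, S.g_B_ξ X.1⟩)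
    (f := fun X ↦ ⟨S.φ X.1, S.g_φ_ξ X.1⟩) hs (a := fun X Y Z ↦ S.g Y.1 (S.dφ X.1 Z.1))
    ?_ ?_ ?_ ?_ ?_ ?_ ?_ ⟨X, hX⟩ ⟨Y, hY⟩ ⟨Z, hZ⟩
  · intro x y z
    rw [g_dφ, S.g_symm]
  · intro x y z
    exact S.g_B_dφ (S.g_dA_eq_zero hs hds) x.2 y.2 z.2
  · intro x y z
    exact S.g_φ_dφ y.2 z.2
  · intro x y z
    simp [B_B, S.P_of_horizontal y.2]
  · intro x y z
    simp [B_φ, dφ_neg]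
  · intro x y z
    simp [φ_φ_eq_neg_P, S.P_of_horizontal z.2, dφ_neg]
  · intro x y z
    have h := S.dφ_cyclic x.1 y.1 z.1
    rw [x.2, y.2, z.2] at h
    linear_combination h

/-! ### The leaves of the contact distribution are flat -/

/-- A curvature-like function is zero if it commutes with two operators `b` (symmetric) and `f`
(skew) that anticommute, the square of `b` being an invertible factor. -/
theorem eq_zero_of_curvatureLike {ι : Type*} {b f : ι → ι} {s : R} (hs : IsUnit s)
    {F : ι → ι → ι → ι → R}
    (h12 : ∀ x y z w, F x y z w = -F y x z w) (h34 : ∀ x y z w, F x y z w = -F x y w z)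
    (hbi : ∀ x y z w, F x y z w + F y z x w + F z x y w = 0)
    (hb : ∀ x y z w, F x y (b z) w = F x y z (b w))
    (hf : ∀ x y z w, F x y (f z) w = -F x y z (f w))
    (hbb : ∀ x y z w, F x y (b (b z)) w = s * F x y z w)
    (hbf : ∀ x y z w, F x y (b (f z)) w = -F x y (f (b z)) w)
    (hff : ∀ x y z w, F x y (f (f z)) w = -F x y z w) (x y z w : ι) : F x y z w = 0 := by
  have hp := pair_symm_of_bianchi h12 h34 hbi
  -- an operator moved between the slots of one pair can be moved between the pairs
  have move : ∀ c : ι → ι, (∀ x y z w, F x y (c z) w = F x y z (c w)) →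
      ∀ x y z w, F (c x) y z w = F x y (c z) w := by
    intro c hc x y z w
    have hc' : ∀ x y z w, F (c x) y z w = F x (c y) z w := fun x y z w ↦ by
      rw [hp, hc, hp]
    apply eq_of_two_mul_eq
    have e1 := hbi (c x) y z w
    have e2 := hbi x (c y) z w
    have e3 := hbi x y (c z) w
    have e4 := hbi x y z (c w)
    have k1 := hc' x y z w
    have k2 := hc' y z x w
    have k3 := hc' z x y w
    have l1 := hc x y z w
    have l2 := hc y z x w
    have l3 := hc z x y w
    linear_combination e1 + e2 - e3 - e4 + k1 - k2 + k3 - l1 - l2 - l3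
  -- the product `b f` is symmetric, since `b` and `f` anticommute
  have hc : ∀ x y z w, F x y (b (f z)) w = F x y z (b (f w)) := by
    intro x y z w
    rw [hb, hf, h34, ← hbf]
    rw [h34 x y z (b (f w)), hbf, neg_neg]
  -- since `f` is `b (b f)` up to the factor `s`, it can be moved between the pairs in two steps
  have hm : ∀ x y z w, F (f x) y z w = -F x y (f z) w := by
    intro x y z w
    apply hs.mul_left_cancel
    have e1 := move b hb
    have e2 := move (fun x ↦ b (f x)) hc
    rw [← hbb, ← e1, e2, hbf, hf, hbb, hf]
    ring
  -- moved to the third slot directly or by way of the fourth, `f` comes with opposite signs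
  have h0 : ∀ x y z w, F x y (f z) w = 0 := by
    intro x y z w
    apply eq_of_two_mul_eq
    linear_combination hm x y z w - h34 (f x) y z w + hm x y w z - h34 x y (f w) z + hf x y z w
  linear_combination -h0 x y (f z) w + hff x y z w

/-- The Levi-Civita connection of the leaves of `ker η`, on horizontal fields. -/
def leafNab (X Y : V) : V := S.nab X Y + S.g (S.A X) Y • S.ξ

theorem g_leafNab_ξ (X : V) {Y : V} (hY : S.g Y S.ξ = 0) : S.g (S.leafNab X Y) S.ξ = 0 := by
  have h := S.metric X Y S.ξ
  rw [hY, map_zero, A_def] at h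
  simp only [leafNab, map_add, map_smul, LinearMap.add_apply, LinearMap.smul_apply, S.g_ξ_ξ,
    smul_eq_mul]
  linear_combination -h + S.g_symm (S.A X) Y

theorem g_leafNab {X Y Z : V} (hZ : S.g Z S.ξ = 0) :
    S.g (S.leafNab X Y) Z = S.g (S.nab X Y) Z := by
  rw [leafNab, map_add, map_smul, LinearMap.add_apply, LinearMap.smul_apply, S.g_symm S.ξ, hZ,
    smul_zero, add_zero]

theorem g_br_ξ {X Y : V} (hX : S.g X S.ξ = 0) (hY : S.g Y S.ξ = 0) :
    S.g (S.br X Y) S.ξ = 0 := by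
  have h := S.dEta X Y
  rw [hX, hY, map_zero, map_zero] at h
  rw [RiemannianCalculus.br]
  linear_combination -h

theorem A_leafNab (hs : IsUnit S.s) (hds : ∀ X, S.g X S.ξ = 0 → S.D X S.s = 0) {X Y : V}
    (hX : S.g X S.ξ = 0) (hY : S.g Y S.ξ = 0) : S.A (S.leafNab X Y) = S.leafNab X (S.A Y) := by
  apply S.ext_horizontal
  · rw [g_A_ξ, S.g_leafNab_ξ X (S.g_A_ξ Y)]
  · intro Z hZ
    have h := S.g_dA_eq_zero hs hds hX hY hZ
    rw [dA, map_sub, LinearMap.sub_apply] at h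
    rw [S.g_leafNab hZ, S.g_A_left, S.g_leafNab (S.g_A_ξ Z), ← S.g_A_left]
    linear_combination -h

theorem φ_leafNab (hs : IsUnit S.s) (hds : ∀ X, S.g X S.ξ = 0 → S.D X S.s = 0) {X Y : V}
    (hX : S.g X S.ξ = 0) (hY : S.g Y S.ξ = 0) : S.φ (S.leafNab X Y) = S.leafNab X (S.φ Y) := by
  apply S.ext_horizontal
  · rw [g_φ_ξ, S.g_leafNab_ξ X (S.g_φ_ξ Y)]
  · intro Z hZ
    have h := S.g_dφ_eq_zero hs hds hX hZ hY
    rw [S.g_symm, dφ, map_sub, LinearMap.sub_apply] at h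
    rw [S.g_leafNab hZ, S.g_φ_left, S.g_leafNab (S.g_φ_ξ Z), ← S.g_φ_left]
    linear_combination -h

/-- The curvature operator of the leaves of `ker η`, on horizontal fields. -/
def leafCurv (X Y Z : V) : V :=
  S.leafNab X (S.leafNab Y Z) - S.leafNab Y (S.leafNab X Z) - S.leafNab (S.br X Y) Z

theorem leafNab_neg (X Y : V) : S.leafNab X (-Y) = -S.leafNab X Y := by
  simp only [leafNab, map_neg]; module

theorem leafNab_sub (X Y Z : V) : S.leafNab X (Y - Z) = S.leafNab X Y - S.leafNab X Z := by
  simp only [leafNab, map_sub]; module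

theorem A_leafCurv (hs : IsUnit S.s) (hds : ∀ X, S.g X S.ξ = 0 → S.D X S.s = 0) {X Y Z : V}
    (hX : S.g X S.ξ = 0) (hY : S.g Y S.ξ = 0) (hZ : S.g Z S.ξ = 0) :
    S.A (S.leafCurv X Y Z) = S.leafCurv X Y (S.A Z) := by
  simp only [leafCurv, map_sub, S.A_leafNab hs hds hX (S.g_leafNab_ξ Y hZ),
    S.A_leafNab hs hds hY (S.g_leafNab_ξ X hZ), S.A_leafNab hs hds hX hZ,
    S.A_leafNab hs hds hY hZ, S.A_leafNab hs hds (S.g_br_ξ hX hY) hZ]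

theorem φ_leafCurv (hs : IsUnit S.s) (hds : ∀ X, S.g X S.ξ = 0 → S.D X S.s = 0) {X Y Z : V}
    (hX : S.g X S.ξ = 0) (hY : S.g Y S.ξ = 0) (hZ : S.g Z S.ξ = 0) :
    S.φ (S.leafCurv X Y Z) = S.leafCurv X Y (S.φ Z) := by
  simp only [leafCurv, map_sub, S.φ_leafNab hs hds hX (S.g_leafNab_ξ Y hZ),
    S.φ_leafNab hs hds hY (S.g_leafNab_ξ X hZ), S.φ_leafNab hs hds hX hZ,
    S.φ_leafNab hs hds hY hZ, S.φ_leafNab hs hds (S.g_br_ξ hX hY) hZ]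

/-- The Gauss equation for the leaves of `ker η`. -/
theorem g_leafCurv (X Y Z : V) {W : V} (hW : S.g W S.ξ = 0) :
    S.g (S.leafCurv X Y Z) W = S.g (S.curv X Y Z) W + S.g (S.A Y) Z * S.g (S.A X) W
      - S.g (S.A X) Z * S.g (S.A Y) W := by
  have h : S.g S.ξ W = 0 := by rw [S.g_symm, hW]
  rw [leafCurv, map_sub, map_sub, LinearMap.sub_apply, LinearMap.sub_apply, S.g_leafNab hW,
    S.g_leafNab hW, S.g_leafNab hW]
  simp only [leafNab, RiemannianCalculus.curv, map_add, map_sub, S.nab_smul, A_def,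
    LinearMap.add_apply, LinearMap.sub_apply, map_smul, LinearMap.smul_apply, smul_eq_mul, h]
  ring

/-- The leaves of `ker η` are flat: their curvature operators commute with `B` and `φ`. -/
theorem g_leafCurv_eq_zero (hs : IsUnit S.s) (hds : ∀ X, S.g X S.ξ = 0 → S.D X S.s = 0)
    {X Y Z W : V} (hX : S.g X S.ξ = 0) (hY : S.g Y S.ξ = 0) (hZ : S.g Z S.ξ = 0)
    (hW : S.g W S.ξ = 0) : S.g (S.leafCurv X Y Z) W = 0 := by
  have hB : ∀ {X Y Z : V}, S.g X S.ξ = 0 → S.g Y S.ξ = 0 → S.g Z S.ξ = 0 →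
      S.B (S.leafCurv X Y Z) = S.leafCurv X Y (S.B Z) := by
    intro X Y Z hX hY hZ
    have h : S.g (S.leafCurv X Y Z) S.ξ = 0 := by
      simp only [leafCurv, map_sub, LinearMap.sub_apply,
        S.g_leafNab_ξ _ (S.g_leafNab_ξ _ hZ), S.g_leafNab_ξ _ hZ, sub_zero]
    rw [S.B_of_horizontal h, S.B_of_horizontal hZ, S.A_leafCurv hs hds hX hY hZ]
    simp only [leafCurv, leafNab_sub]
    abel
  have hneg : ∀ X Y Z : V, S.leafCurv X Y (-Z) = -S.leafCurv X Y Z := by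
    intro X Y Z
    simp only [leafCurv, leafNab_neg]; abel
  let ι := {X : V // S.g X S.ξ = 0}
  refine eq_zero_of_curvatureLike (ι := ι) (b := fun X ↦ ⟨S.B X.1, S.g_B_ξ X.1⟩)
    (f := fun X ↦ ⟨S.φ X.1, S.g_φ_ξ X.1⟩) hs
    (F := fun X Y Z W ↦ S.g (S.leafCurv X.1 Y.1 Z.1) W.1)
    ?_ ?_ ?_ ?_ ?_ ?_ ?_ ?_ ⟨X, hX⟩ ⟨Y, hY⟩ ⟨Z, hZ⟩ ⟨W, hW⟩
  · intro x y z w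
    simp only [S.g_leafCurv _ _ _ w.2, S.curv_swap x.1 y.1, map_neg, LinearMap.neg_apply]
    ring
  · intro x y z w
    simp only [S.g_leafCurv _ _ _ w.2, S.g_leafCurv _ _ _ z.2]
    linear_combination S.curv_skew S.g_ξ_ξ x.1 y.1 z.1 w.1
  · intro x y z w
    have h := congrArg (fun U ↦ S.g U w.1) (S.bianchi x.1 y.1 z.1)
    simp only [map_add, LinearMap.add_apply, map_zero, LinearMap.zero_apply] at h
    simp only [S.g_leafCurv _ _ _ w.2, S.g_A_left _ x.1, S.g_A_left _ y.1, S.g_A_left _ z.1]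
    rw [S.g_symm y.1 (S.A x.1), S.g_symm z.1 (S.A y.1), S.g_symm x.1 (S.A z.1)]
    simp only [S.g_A_left _ x.1, S.g_A_left _ y.1, S.g_A_left _ z.1]
    linear_combination h
  · intro x y z w
    rw [← S.g_B_left, hB x.2 y.2 z.2]
  · intro x y z w
    rw [← S.φ_leafCurv hs hds x.2 y.2 z.2, S.g_φ_left]
  · intro x y z w
    rw [← hB x.2 y.2 (S.g_B_ξ z.1), ← hB x.2 y.2 z.2, B_B, S.P_def, map_smul,
      LinearMap.smul_apply, smul_eq_mul]
    have h : S.g S.ξ w.1 = 0 := by rw [S.g_symm, w.2]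
    simp [h]
  · intro x y z w
    simp [B_φ, hneg]
  · intro x y z w
    simp [φ_φ_eq_neg_P, S.P_of_horizontal z.2, hneg]

theorem g_curv_ξ (X Y W : V) :
    S.g (S.curv X Y S.ξ) W = S.g Y S.ξ * S.m X W - S.g X S.ξ * S.m Y W := by
  rw [S.nullity, S.h_eq, S.h_eq]
  simp only [m, P_def, map_sub, map_add, map_smul, LinearMap.sub_apply, LinearMap.add_apply,
    LinearMap.smul_apply, smul_eq_mul]
  ring

theorem m_ξ (X : V) : S.m X S.ξ = 0 := by
  simp [m, g_P_ξ, g_φ_ξ]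

/-- By pair symmetry and the nullity condition, `R(ξ, Y) Z` has no horizontal part for horizontal
`Z`. -/
theorem g_curv_horizontal (X Y : V) {Z W : V} (hZ : S.g Z S.ξ = 0) (hW : S.g W S.ξ = 0) :
    S.g (S.curv X Y Z) W = S.g (S.curv (S.P X) (S.P Y) Z) W := by
  have hp := pair_symm_of_bianchi (F := fun X Y Z W ↦ S.g (S.curv X Y Z) W)
    (fun x y z w ↦ by simp [S.curv_swap x y]) (S.curv_skew S.g_ξ_ξ)
    (fun x y z w ↦ by simp [← LinearMap.add_apply, ← map_add, S.bianchi])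
  have h1 : ∀ X Y, S.g (S.curv X Y Z) W = S.g (S.curv X (S.P Y) Z) W := by
    intro X Y
    have h2 := S.curv_skew S.g_ξ_ξ Z W X S.ξ
    rw [g_curv_ξ, hZ, hW] at h2
    rw [hp X Y Z W, hp X (S.P Y) Z W, P_def, map_sub, map_smul, h2]
    simp
  rw [h1, S.curv_swap, map_neg, LinearMap.neg_apply, h1, S.curv_swap, map_neg,
    LinearMap.neg_apply, neg_neg]

/-- The curvature tensor of `M`, in terms of the shape operator of the leaves and the nullity
condition. -/
theorem g_curv (hs : IsUnit S.s) (hds : ∀ X, S.g X S.ξ = 0 → S.D X S.s = 0) (X Y Z W : V) :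
    S.g (S.curv X Y Z) W = S.g (S.A X) Z * S.g (S.A Y) W - S.g (S.A Y) Z * S.g (S.A X) W
      + S.g Z S.ξ * (S.g Y S.ξ * S.m X W - S.g X S.ξ * S.m Y W)
      - S.g W S.ξ * (S.g Y S.ξ * S.m X Z - S.g X S.ξ * S.m Y Z) := by
  have hA : ∀ X, S.A (S.P X) = S.A X := fun X ↦ by simp [P_def, A_ξ]
  have h1 : S.g (S.curv X Y (S.P Z)) (S.P W)
      = S.g (S.A X) Z * S.g (S.A Y) W - S.g (S.A Y) Z * S.g (S.A X) W := by
    have h2 := S.g_leafCurv_eq_zero hs hds (S.g_P_ξ X) (S.g_P_ξ Y) (S.g_P_ξ Z) (S.g_P_ξ W)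
    rw [S.g_leafCurv _ _ _ (S.g_P_ξ W), hA, hA] at h2
    have h3 : ∀ X Y, S.g (S.A X) (S.P Y) = S.g (S.A X) Y := fun X Y ↦ by
      rw [S.g_A_left, hA, S.g_A_left]
    rw [h3, h3, h3, h3] at h2
    rw [S.g_curv_horizontal X Y (S.g_P_ξ Z) (S.g_P_ξ W)]
    linear_combination h2
  have h4 := S.curv_skew S.g_ξ_ξ X Y (S.P Z) W
  have h5 := S.curv_skew S.g_ξ_ξ X Y (S.P Z) S.ξ
  have h6 := S.curv_skew S.g_ξ_ξ X Y Z W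
  have h7 := S.curv_skew S.g_ξ_ξ X Y W S.ξ
  rw [S.P_def W, map_sub, map_smul, smul_eq_mul, h4, h5] at h1
  simp only [P_def, map_sub, map_smul, smul_eq_mul, g_curv_ξ, m_ξ, h7] at h1
  rw [h6]
  linear_combination h1

/-! ### The critical point equation in the calculus -/

/-- The Ricci tensor of a `(κ, μ)`-almost Kenmotsu manifold of dimension `2n + 1`, given by its
value `2 B - 2 n A + μ h + 2 n κ η ⊗ η` rather than as a trace. -/
def ric (n : ℕ) (X Y : V) : R :=
  2 * S.g (S.B X) Y - 2 * n * S.g (S.A X) Y + S.μ * S.g (S.φ (S.B X)) Y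
    + 2 * n * S.κ * (S.g X S.ξ * S.g Y S.ξ)

/-- The scalar curvature of a `(κ, μ)`-almost Kenmotsu manifold of dimension `2n + 1`, given by its
value. -/
def scal (n : ℕ) : R := 2 * n * S.κ - 4 * n ^ 2

variable {S} {n : ℕ} {G : V} {u f : R}

/-- The derivative of the function `ξ u`, where `G = grad u` and `Hess u = u Ric + f g`. -/
theorem D_g_ξ
    (hH : ∀ X Y, S.g (S.nab X G) Y = u * S.ric n X Y + f * S.g X Y) (X : V) :
    S.D X (S.g G S.ξ) = (2 * n * S.κ * u + f) * S.g X S.ξ + S.g (S.A X) G := by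
  rw [S.metric, hH, ric, S.g_B_ξ, S.g_A_ξ, S.g_φ_ξ, S.g_ξ_ξ, S.A_def, S.g_symm G]
  ring

/-- The integrability condition for the function `ξ u`, whose derivative is `D_g_ξ`. -/
theorem integrability
    (hH : ∀ X Y, S.g (S.nab X G) Y = u * S.ric n X Y + f * S.g X Y) (X Y : V) :
    S.D X (2 * n * S.κ * u + f) * S.g Y S.ξ - S.D Y (2 * n * S.κ * u + f) * S.g X S.ξ
      + S.g (S.curv X Y S.ξ) G + S.g (S.A Y) (S.nab X G) - S.g (S.A X) (S.nab Y G) = 0 := by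
  have h1 := S.D_br S.g_ξ_ξ X Y (S.g G S.ξ)
  have h2 := S.dEta X Y
  have hX := congrArg (S.D Y) (D_g_ξ hH X)
  have hY := congrArg (S.D X) (D_g_ξ hH Y)
  have h3 : S.g (S.A (S.br X Y)) G = S.g (S.A (S.nab X Y)) G - S.g (S.A (S.nab Y X)) G := by
    simp [RiemannianCalculus.br]
  have h4 : S.g (S.br X Y) S.ξ = S.g (S.nab X Y - S.nab Y X) S.ξ := rfl
  rw [D_g_ξ hH (S.br X Y), h3, h4] at h1
  rw [map_add, Derivation.leibniz, S.metric _ (S.A _), smul_eq_mul, smul_eq_mul] at hX hY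
  rw [S.curv_ξ, dA, dA]
  simp only [map_sub, LinearMap.sub_apply] at h1 h2 ⊢
  linear_combination -h1 + hX - hY - (2 * n * S.κ * u + f) * h2

theorem g_B_B {X : V} (hX : S.g X S.ξ = 0) (Y : V) : S.g (S.B X) (S.B Y) = S.s * S.g X Y := by
  rw [← S.g_B_left, S.B_B, S.P_of_horizontal hX, map_smul, LinearMap.smul_apply, smul_eq_mul]

theorem isUnit_natCast {k : ℕ} (hk : k ≠ 0) : IsUnit (k : R) := by
  have := (IsUnit.mk0 (k : ℝ) (by exact_mod_cast hk)).map (algebraMap ℝ R)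
  rwa [map_natCast] at this

/-- The horizontal part of the integrability condition. On horizontal fields the form
`⟨A Y, ∇_X G⟩` is symmetric but for the term `u μ h`, because `A` commutes with `B` and not with
`h`. -/
theorem u_mul_μ_mul_g_P_eq_zero (hs : IsUnit S.s)
    (hH : ∀ X Y, S.g (S.nab X G) Y = u * S.ric n X Y + f * S.g X Y) (X : V) :
    u * S.μ * S.g (S.P X) X = 0 := by
  have key : ∀ X Y, S.g X S.ξ = 0 → S.g Y S.ξ = 0 → u * S.μ * S.g X (S.φ Y) = 0 := by
    intro X Y hX hY
    have h := integrability hH X Y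
    rw [hX, hY, S.g_curv_ξ, hX, hY, S.g_symm (S.A Y), S.g_symm (S.A X), hH, hH, ric, ric,
      S.g_A_ξ, S.g_A_ξ] at h
    have hs3 : S.g Y (S.B X) = S.g X (S.B Y) := by rw [S.g_symm, S.g_B_left]
    have e1 := S.g_B_B hX Y
    have e2 := S.g_B_B hY X
    have e3 := S.g_B_left X Y
    have e4 := S.g_B_left X (S.φ Y)
    have e5 := S.g_B_B hX (S.φ Y)
    have e6 := S.g_φ_left (S.B X) (S.B Y)
    have e7 := S.g_φ_left (S.B X) Y
    have e8 := S.g_symm (S.φ (S.B Y)) (S.B X)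
    have e9 := S.g_symm (S.φ (S.B Y)) X
    have e10 : S.A X = S.B X + X := by rw [S.B_of_horizontal hX]; abel
    have e11 : S.A Y = S.B Y + Y := by rw [S.B_of_horizontal hY]; abel
    rw [S.B_φ, map_neg] at e4 e5
    rw [e10, e11] at h
    simp only [map_add, LinearMap.add_apply, e1, e2, e3, e6, e7, e8, e9,
      S.g_symm (S.B Y) X, S.g_symm Y X, hs3] at h
    apply hs.mul_left_cancel
    apply eq_of_two_mul_eq
    linear_combination h + u * S.μ * e4 - 2 * u * S.μ * e5
  have h := key (S.P X) (S.φ X) (S.g_P_ξ X) (S.g_φ_ξ X)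
  rw [S.φ_φ_eq_neg_P, map_neg, ← S.g_P_left, S.P_of_horizontal (S.g_P_ξ X)] at h
  linear_combination -h

/-- The mixed part of the integrability condition: when `μ = 0`, the gradient of `u` is a multiple
of `ξ`. -/
theorem D_eq_zero (hs : IsUnit S.s) (hds : ∀ X, S.g X S.ξ = 0 → S.D X S.s = 0) (hn : 0 < n)
    (hμ : S.μ = 0) (hG : ∀ X, S.g G X = S.D X u)
    (hH : ∀ X Y, S.g (S.nab X G) Y = u * S.ric n X Y + f * S.g X Y)
    (hf : (2 * n * (2 * n + 1)) * f
      = - (2 * n + 1) * S.scal n * (u - 1) - 2 * n * S.scal n) {X : V}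
    (hX : S.g X S.ξ = 0) : S.D X u = 0 := by
  have h := integrability hH X S.ξ
  rw [S.g_symm (S.A X), hH, ric, S.g_curv_ξ, hX, S.A_ξ, S.B_ξ, S.g_ξ_ξ, m, hμ,
    S.P_of_horizontal hX, S.g_symm S.ξ, S.g_A_ξ, S.g_symm X G, hG] at h
  have h2 : S.D X 2 = 0 := by simpa using (S.D X).map_natCast 2
  have h4 : S.D X 4 = 0 := by simpa using (S.D X).map_natCast 4
  have hκ : S.D X S.κ = 0 := by
    have := hds X hX
    rw [s, map_neg, map_add, Derivation.map_one_eq_zero, add_zero] at this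
    exact neg_eq_zero.mp this
  have hf' := congrArg (S.D X) hf
  simp only [scal, map_add, map_sub, map_neg, Derivation.leibniz, Derivation.leibniz_pow,
    Derivation.map_natCast, Derivation.map_one_eq_zero, h2, h4, hκ, smul_eq_mul, mul_zero, zero_mul,
    add_zero, zero_add, sub_zero, neg_zero, smul_zero, map_zero, LinearMap.zero_apply] at h hf'
  -- `h` says that `(2 n + 1) κ X u + X f = 0`, where `X f = (2 n - κ) X u`; the sum is `-2 n s X u`
  have hu : IsUnit ((4 * n ^ 2 * (2 * n + 1) : ℕ) : R) := isUnit_natCast (by positivity)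
  apply (hu.mul hs).mul_left_cancel
  push_cast
  rw [s]
  linear_combination hf' - 2 * n * (2 * n + 1) * h

/-- A solution of the critical point equation with `μ = 0` is determined to first order along `ξ`,
and the second derivative along `ξ` then gives an equation without derivatives. -/
theorem u_mul_eq_zero (hs : IsUnit S.s) (hds : ∀ X, S.g X S.ξ = 0 → S.D X S.s = 0) (hn : 0 < n)
    (hμ : S.μ = 0) (hG : ∀ X, S.g G X = S.D X u)
    (hH : ∀ X Y, S.g (S.nab X G) Y = u * S.ric n X Y + f * S.g X Y)
    (hf : (2 * n * (2 * n + 1)) * f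
      = - (2 * n + 1) * S.scal n * (u - 1) - 2 * n * S.scal n)
    (hP : ∀ a : R, (∀ X, a * S.g (S.P X) X = 0) → a = 0) :
    u * (4 * (n - 1) ^ 2 - 2 - 2 * n * S.κ) = 0 := by
  have hGξ : G = S.g G S.ξ • S.ξ := by
    refine S.ext_horizontal (by simp [S.g_ξ_ξ]) fun Z hZ ↦ ?_
    rw [hG, D_eq_zero hs hds hn hμ hG hH hf hZ, map_smul, LinearMap.smul_apply, S.g_symm S.ξ, hZ,
      smul_zero]
  have hξ := D_g_ξ hH S.ξ
  rw [S.A_ξ, map_zero, LinearMap.zero_apply, S.g_ξ_ξ] at hξ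
  have hu := hG S.ξ
  set σ := S.g G S.ξ
  have key : ∀ X Y, S.g X S.ξ = 0 → S.g Y S.ξ = 0 →
      (σ + 2 * n * u - f) * S.g X Y + (σ + 2 * n * u - 2 * u) * S.g (S.B X) Y = 0 := by
    intro X Y hX hY
    have h := hH X Y
    have hA : S.A X = S.B X + X := by rw [S.B_of_horizontal hX]; abel
    have h0 : S.g S.ξ Y = 0 := by rw [S.g_symm, hY]
    rw [hGξ, S.nab_smul, ric, hμ, hX, S.A_def, hA] at h
    simp only [map_add, map_smul, LinearMap.add_apply, LinearMap.smul_apply, smul_eq_mul, h0] at h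
    linear_combination h
  -- the terms in `B` cancel between a pair of fields `X`, `φ X`
  have hα : σ + 2 * n * u - f = 0 := by
    refine hP _ fun X ↦ eq_of_two_mul_eq ?_
    have h1 := key (S.P X) (S.P X) (S.g_P_ξ X) (S.g_P_ξ X)
    have h2 := key (S.φ (S.P X)) (S.φ (S.P X)) (S.g_φ_ξ _) (S.g_φ_ξ _)
    rw [S.B_φ, map_neg, LinearMap.neg_apply, S.g_φ_φ, S.g_φ_φ, S.g_B_ξ, S.g_P_ξ] at h2
    have h3 : S.g (S.P X) (S.P X) = S.g (S.P X) X := by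
      rw [← S.g_P_left, S.P_of_horizontal (S.g_P_ξ X)]
    rw [h3] at h1 h2
    linear_combination h1 + h2
  -- with the other coefficient zero, `B² = s P` isolates the coefficient of `B`
  have hγ : σ + 2 * n * u - 2 * u = 0 := by
    refine hP _ fun X ↦ hs.mul_left_cancel ?_
    have h1 := key (S.P X) (S.B X) (S.g_P_ξ X) (S.g_B_ξ X)
    rw [hα, S.g_B_B (S.g_P_ξ X)] at h1
    linear_combination h1
  have hσ : σ = -2 * (n - 1) * u := by linear_combination hγ
  have h2 : S.D S.ξ 2 = 0 := by simpa using (S.D S.ξ).map_natCast 2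
  rw [hσ] at hξ hα
  simp only [map_sub, map_neg, Derivation.leibniz, Derivation.map_natCast,
    Derivation.map_one_eq_zero, h2, ← hu, smul_eq_mul, mul_zero, add_zero, sub_zero, neg_zero] at hξ
  rw [hσ] at hξ
  linear_combination hξ - hα

end KappaMuCalculus

end

/-! ### Traces on a tangent space -/

theorem sum_inner_mul_apply {T ι : Type*} [NormedAddCommGroup T] [InnerProductSpace ℝ T]
    [Fintype ι] (e : OrthonormalBasis ι ℝ T) (δ : T →ₗ[ℝ] ℝ) (v : T) :
    ∑ i, inner ℝ v (e i) * δ (e i) = δ v := by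
  conv_rhs => rw [← e.sum_repr' v]
  simp [real_inner_comm]

theorem sum_inner_apply_self {T ι : Type*} [NormedAddCommGroup T] [InnerProductSpace ℝ T]
    [Fintype ι] (e : OrthonormalBasis ι ℝ T) (f : T →ₗ[ℝ] T) :
    ∑ i, (inner ℝ (f (e i)) (e i) : ℝ) = LinearMap.trace ℝ T f := by
  rw [LinearMap.trace_eq_sum_inner f e]
  exact Finset.sum_congr rfl fun i _ ↦ real_inner_comm _ _

/-- The tensors of an almost Kenmotsu structure on a single tangent space: the Reeb vector `ξ`,
the structure tensor `φ`, and the trace-free part `B` of the shape operator. -/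
structure ContactVectorSpace (T : Type*) [NormedAddCommGroup T] [InnerProductSpace ℝ T] where
  /-- the Reeb vector -/
  ξ : T
  /-- the structure tensor -/
  φ : T →ₗ[ℝ] T
  /-- the trace-free part of the shape operator -/
  B : T →ₗ[ℝ] T
  /-- the factor in `B ^ 2 = s P`, where `P` is the projection along `ξ` -/
  s : ℝ
  inner_ξ_ξ : inner ℝ ξ ξ = (1 : ℝ)
  φ_φ : ∀ v, φ (φ v) = -v + (inner ℝ v ξ : ℝ) • ξ
  inner_φ_left : ∀ v w, (inner ℝ (φ v) w : ℝ) = -inner ℝ v (φ w)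
  inner_B_left : ∀ v w, (inner ℝ (B v) w : ℝ) = inner ℝ v (B w)
  B_ξ : B ξ = 0
  B_φ : ∀ v, B (φ v) = -φ (B v)
  B_B : ∀ v, B (B v) = s • (v - (inner ℝ v ξ : ℝ) • ξ)

namespace ContactVectorSpace

variable {T ι : Type*} [NormedAddCommGroup T] [InnerProductSpace ℝ T] [Fintype ι]
  (e : OrthonormalBasis ι ℝ T) (K : ContactVectorSpace T)

theorem inner_B_ξ (v : T) : inner ℝ (K.B v) K.ξ = (0 : ℝ) := by
  rw [K.inner_B_left, K.B_ξ, inner_zero_right]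

/-- Both `φ B φ = B` and `φ² B = -B` hold, so that `B` has the same trace as `-B`. -/
theorem sum_inner_B : ∑ i, (inner ℝ (K.B (e i)) (e i) : ℝ) = 0 := by
  have h1 : K.φ * (K.B * K.φ) = K.B := by
    ext v
    simp [K.B_φ, K.φ_φ, K.inner_B_ξ]
  have h2 : (K.B * K.φ) * K.φ = -K.B := by
    ext v
    simp [K.φ_φ, K.B_ξ]
  have h3 := LinearMap.trace_mul_comm ℝ K.φ (K.B * K.φ)
  rw [h1, h2, map_neg] at h3
  rw [sum_inner_apply_self]
  linarith

/-- As `φ B = -B φ`, the trace of `φ B` is zero. -/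
theorem sum_inner_φ_B : ∑ i, (inner ℝ (K.φ (K.B (e i))) (e i) : ℝ) = 0 := by
  have h1 : K.B * K.φ = -(K.φ * K.B) := by
    ext v
    simp [K.B_φ]
  have h3 := LinearMap.trace_mul_comm ℝ K.φ K.B
  rw [h1, map_neg] at h3
  have h4 := sum_inner_apply_self e (K.φ * K.B)
  simp only [Module.End.mul_apply] at h4
  linarith

theorem sum_inner_ξ_mul_self : ∑ i, (inner ℝ (e i) K.ξ * inner ℝ (e i) K.ξ : ℝ) = 1 := by
  rw [← K.inner_ξ_ξ, ← e.sum_inner_mul_inner K.ξ K.ξ]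
  exact Finset.sum_congr rfl fun i _ ↦ by rw [real_inner_comm]

theorem sum_inner_self : ∑ i, (inner ℝ (e i) (e i) : ℝ) = Module.finrank ℝ T := by
  simp [Module.finrank_eq_card_basis e.toBasis]

/-- The trace of the relation satisfied by the differential `δ` of the function `s` shows that
`δ` vanishes on the contact distribution, in dimension greater than three. -/
theorem eq_zero_of_relation [FiniteDimensional ℝ T] {n : ℕ} (hn : 1 < n)
    (hT : Module.finrank ℝ T = 2 * n + 1)
    (hs : K.s ≠ 0) (δ : T →ₗ[ℝ] ℝ)
    (h : ∀ a b c : T, inner ℝ a K.ξ = (0 : ℝ) → inner ℝ b K.ξ = (0 : ℝ) →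
      inner ℝ c K.ξ = (0 : ℝ) → δ (K.B b) * inner ℝ a c - δ a * inner ℝ (K.B b) c
        = δ (K.B a) * inner ℝ b c - δ b * inner ℝ (K.B a) c)
    {v : T} (hv : inner ℝ v K.ξ = (0 : ℝ)) : δ v = 0 := by
  have key : ∀ b : T, inner ℝ b K.ξ = (0 : ℝ) → δ (K.B b) = 0 := by
    intro b hb
    let e := stdOrthonormalBasis ℝ T
    have hP : ∀ a : T, inner ℝ (a - (inner ℝ a K.ξ : ℝ) • K.ξ) K.ξ = (0 : ℝ) := fun a ↦ by
      rw [inner_sub_left, real_inner_smul_left, K.inner_ξ_ξ, mul_one, sub_self]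
    have h1 : ∀ i, δ (K.B b) * (inner ℝ (e i) (e i) - inner ℝ (e i) K.ξ * inner ℝ (e i) K.ξ)
        - (inner ℝ (K.B b) (e i) * δ (e i) - δ K.ξ * (inner ℝ (K.B b) (e i) * inner ℝ (e i) K.ξ))
        = inner ℝ b (e i) * δ (K.B (e i)) - δ b * inner ℝ (K.B (e i)) (e i) := by
      intro i
      have h2 := h _ b _ (hP (e i)) hb (hP (e i))
      simp only [map_sub, map_smul, K.B_ξ, smul_zero, sub_zero, inner_sub_left, inner_sub_right,
        inner_smul_left, inner_smul_right, K.inner_ξ_ξ, K.inner_B_ξ, hb, smul_eq_mul,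
        real_inner_comm (e i) K.ξ, conj_trivial] at h2
      linear_combination h2
    have h3 := Finset.sum_congr (s₁ := Finset.univ) rfl fun i _ ↦ h1 i
    simp only [Finset.sum_sub_distrib, ← Finset.mul_sum, sum_inner_self, K.sum_inner_ξ_mul_self,
      sum_inner_mul_apply, K.sum_inner_B] at h3
    have h4 := sum_inner_mul_apply e (δ ∘ₗ K.B) b
    simp only [LinearMap.comp_apply] at h4
    have hT' : (Module.finrank ℝ T : ℝ) = 2 * n + 1 := by exact_mod_cast hT
    rw [e.sum_inner_mul_inner, K.inner_B_ξ, h4, hT'] at h3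
    have hn' : (1 : ℝ) < n := by exact_mod_cast hn
    have h5 : (2 * (n : ℝ) - 2) * δ (K.B b) = 0 := by linear_combination h3
    exact (mul_eq_zero.mp h5).resolve_left (by linarith)
  have h6 := key (K.B v) (K.inner_B_ξ v)
  rw [K.B_B, hv, zero_smul, sub_zero, map_smul, smul_eq_mul] at h6
  exact (mul_eq_zero.mp h6).resolve_left hs

/-- The projection onto the contact distribution. -/
def P : T →ₗ[ℝ] T where
  toFun v := v - (inner ℝ v K.ξ : ℝ) • K.ξ
  map_add' v w := by rw [inner_add_left]; module
  map_smul' c v := by rw [real_inner_smul_left, RingHom.id_apply]; module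

/-- The shape operator. -/
def A : T →ₗ[ℝ] T := K.B + K.P

theorem P_apply (v : T) : K.P v = v - (inner ℝ v K.ξ : ℝ) • K.ξ := rfl

theorem A_apply (v : T) : K.A v = K.B v + K.P v := rfl

theorem inner_P_ξ (v : T) : inner ℝ (K.P v) K.ξ = (0 : ℝ) := by
  rw [P_apply, inner_sub_left, real_inner_smul_left, K.inner_ξ_ξ, mul_one, sub_self]

theorem inner_P_left (v w : T) : (inner ℝ (K.P v) w : ℝ) = inner ℝ v (K.P w) := by
  rw [P_apply, P_apply, inner_sub_left, inner_sub_right, real_inner_smul_left,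
    real_inner_smul_right, real_inner_comm w K.ξ]
  ring

theorem inner_A_left (v w : T) : (inner ℝ (K.A v) w : ℝ) = inner ℝ v (K.A w) := by
  rw [A_apply, A_apply, inner_add_left, inner_add_right, inner_P_left, inner_B_left]

theorem A_A (v : T) : K.A (K.A v) = (2 : ℝ) • K.B v + (K.s + 1) • K.P v := by
  simp only [A_apply, P_apply, map_add, map_sub, map_smul, K.B_B, K.B_ξ,
    K.inner_ξ_ξ, K.inner_B_ξ]
  module

theorem sum_inner_P {n : ℕ} (hT : Module.finrank ℝ T = 2 * n + 1) :
    ∑ i, (inner ℝ (K.P (e i)) (e i) : ℝ) = 2 * n := by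
  simp only [P_apply, inner_sub_left, real_inner_smul_left, real_inner_comm (e _) K.ξ,
    Finset.sum_sub_distrib, K.sum_inner_ξ_mul_self, sum_inner_self, hT]
  push_cast
  ring

theorem sum_inner_A {n : ℕ} (hT : Module.finrank ℝ T = 2 * n + 1) :
    ∑ i, (inner ℝ (K.A (e i)) (e i) : ℝ) = 2 * n := by
  simp only [A_apply, inner_add_left, Finset.sum_add_distrib, K.sum_inner_B, K.sum_inner_P e hT,
    zero_add]

/-- The form `⟨R(v, ξ) ξ, w⟩` given by the nullity condition with coefficients `κ`, `μ`. -/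
def m (κ μ : ℝ) : T →ₗ[ℝ] T := κ • K.P + μ • (K.φ ∘ₗ K.B)

theorem m_apply (κ μ : ℝ) (v : T) : K.m κ μ v = κ • K.P v + μ • K.φ (K.B v) := rfl

theorem m_ξ (κ μ : ℝ) : K.m κ μ K.ξ = 0 := by
  rw [m_apply, P_apply, K.inner_ξ_ξ, K.B_ξ]
  simp

theorem inner_φ_ξ (v : T) : inner ℝ (K.φ v) K.ξ = (0 : ℝ) := by
  have h : K.φ K.ξ = 0 := by
    have h1 := K.φ_φ K.ξ
    rw [K.inner_ξ_ξ, one_smul, neg_add_cancel] at h1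
    have h2 := K.inner_φ_left K.ξ (K.φ K.ξ)
    rw [h1, inner_zero_right, neg_zero] at h2
    exact inner_self_eq_zero.mp h2
  rw [K.inner_φ_left, h, inner_zero_right, neg_zero]

/-- The Ricci tensor, as the trace of the curvature tensor. -/
theorem sum_curvature {n : ℕ} (hT : Module.finrank ℝ T = 2 * n + 1) {κ : ℝ} (hκ : K.s = -(κ + 1))
    (μ : ℝ) (v w : T) :
    ∑ i, (inner ℝ (K.A (e i)) w * inner ℝ (K.A v) (e i)
      - inner ℝ (K.A v) w * inner ℝ (K.A (e i)) (e i)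
      + inner ℝ w K.ξ * (inner ℝ v K.ξ * inner ℝ (K.m κ μ (e i)) (e i)
        - inner ℝ (e i) K.ξ * inner ℝ (K.m κ μ v) (e i))
      - inner ℝ (e i) K.ξ * (inner ℝ v K.ξ * inner ℝ (K.m κ μ (e i)) w
        - inner ℝ (e i) K.ξ * inner ℝ (K.m κ μ v) w) : ℝ)
    = 2 * inner ℝ (K.B v) w - 2 * n * inner ℝ (K.A v) w + μ * inner ℝ (K.φ (K.B v)) w
      + 2 * n * κ * (inner ℝ v K.ξ * inner ℝ w K.ξ) := by
  have h1 : ∑ i, (inner ℝ (K.A (e i)) w * inner ℝ (K.A v) (e i) : ℝ)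
      = 2 * inner ℝ (K.B v) w + (K.s + 1) * inner ℝ (K.P v) w := by
    rw [← real_inner_smul_left, ← real_inner_smul_left, ← inner_add_left, ← A_A, K.inner_A_left,
      ← e.sum_inner_mul_inner]
    exact Finset.sum_congr rfl fun i _ ↦ by rw [K.inner_A_left, mul_comm]
  have h2 : ∑ i, (inner ℝ (K.m κ μ (e i)) (e i) : ℝ) = 2 * n * κ := by
    simp only [m_apply, inner_add_left, real_inner_smul_left, Finset.sum_add_distrib,
      ← Finset.mul_sum, K.sum_inner_P e hT, K.sum_inner_φ_B]
    ring
  have h3 : ∑ i, (inner ℝ (e i) K.ξ * inner ℝ (K.m κ μ v) (e i) : ℝ) = 0 := by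
    simp only [mul_comm (inner ℝ (e _) K.ξ : ℝ), e.sum_inner_mul_inner]
    rw [m_apply, inner_add_left, real_inner_smul_left, real_inner_smul_left, K.inner_P_ξ,
      K.inner_φ_ξ]
    ring
  have h4 : ∑ i, (inner ℝ (e i) K.ξ * inner ℝ (K.m κ μ (e i)) w : ℝ) = 0 := by
    have h5 := sum_inner_mul_apply e ((innerₗ T w) ∘ₗ K.m κ μ) K.ξ
    simpa [K.m_ξ, real_inner_comm] using h5
  have h5 : (inner ℝ (K.m κ μ v) w : ℝ)
      = κ * inner ℝ (K.P v) w + μ * inner ℝ (K.φ (K.B v)) w := by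
    rw [m_apply, inner_add_left, real_inner_smul_left, real_inner_smul_left]
  have h6 : ∀ i, (inner ℝ (K.A (e i)) w * inner ℝ (K.A v) (e i)
      - inner ℝ (K.A v) w * inner ℝ (K.A (e i)) (e i)
      + inner ℝ w K.ξ * (inner ℝ v K.ξ * inner ℝ (K.m κ μ (e i)) (e i)
        - inner ℝ (e i) K.ξ * inner ℝ (K.m κ μ v) (e i))
      - inner ℝ (e i) K.ξ * (inner ℝ v K.ξ * inner ℝ (K.m κ μ (e i)) w
        - inner ℝ (e i) K.ξ * inner ℝ (K.m κ μ v) w) : ℝ)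
      = inner ℝ (K.A (e i)) w * inner ℝ (K.A v) (e i)
      - inner ℝ (K.A v) w * inner ℝ (K.A (e i)) (e i)
      + inner ℝ w K.ξ * (inner ℝ v K.ξ) * inner ℝ (K.m κ μ (e i)) (e i)
      - inner ℝ w K.ξ * (inner ℝ (e i) K.ξ * inner ℝ (K.m κ μ v) (e i))
      - inner ℝ v K.ξ * (inner ℝ (e i) K.ξ * inner ℝ (K.m κ μ (e i)) w)
      + inner ℝ (K.m κ μ v) w * (inner ℝ (e i) K.ξ * inner ℝ (e i) K.ξ) := fun i ↦ by ring
  simp only [h6, Finset.sum_add_distrib, Finset.sum_sub_distrib, ← Finset.mul_sum, h1, h2, h3, h4,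
    K.sum_inner_A e hT, K.sum_inner_ξ_mul_self]
  rw [h5, hκ]
  ring

theorem sum_ricci {n : ℕ} (hT : Module.finrank ℝ T = 2 * n + 1) (κ μ : ℝ) :
    ∑ i, (2 * inner ℝ (K.B (e i)) (e i) - 2 * n * inner ℝ (K.A (e i)) (e i)
      + μ * inner ℝ (K.φ (K.B (e i))) (e i)
      + 2 * n * κ * (inner ℝ (e i) K.ξ * inner ℝ (e i) K.ξ) : ℝ) = 2 * n * κ - 4 * n ^ 2 := by
  simp only [Finset.sum_add_distrib, Finset.sum_sub_distrib, ← Finset.mul_sum, K.sum_inner_B,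
    K.sum_inner_A e hT, K.sum_inner_φ_B, K.sum_inner_ξ_mul_self]
  ring

/-- The trace of `B ^ 2 = s P` shows that `s` is nonnegative, since `B` is self-adjoint. -/
theorem s_nonneg [FiniteDimensional ℝ T] {n : ℕ} (hn : 0 < n)
    (hT : Module.finrank ℝ T = 2 * n + 1) : 0 ≤ K.s := by
  have hn' : (0 : ℝ) < n := by exact_mod_cast hn
  have h : K.s * (2 * n) = ∑ i, (inner ℝ (K.B (stdOrthonormalBasis ℝ T i))
      (K.B (stdOrthonormalBasis ℝ T i)) : ℝ) := by
    rw [← K.sum_inner_P (stdOrthonormalBasis ℝ T) hT, Finset.mul_sum]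
    refine Finset.sum_congr rfl fun i _ ↦ ?_
    rw [← K.inner_B_left, K.B_B, real_inner_smul_left, K.P_apply]
  exact nonneg_of_mul_nonneg_left
    (h ▸ Finset.sum_nonneg fun i _ ↦ real_inner_self_nonneg) (by positivity)

theorem B_eq_zero (hs : K.s = 0) (v : T) : K.B v = 0 := by
  have h := K.inner_B_left v (K.B v)
  rw [K.B_B, hs, zero_smul, inner_zero_right] at h
  exact inner_self_eq_zero.mp h

theorem eq_zero_of_mul_inner_P [FiniteDimensional ℝ T] {n : ℕ} (hn : 0 < n)
    (hT : Module.finrank ℝ T = 2 * n + 1) {a : ℝ}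
    (h : ∀ v, a * inner ℝ (K.P v) v = 0) : a = 0 := by
  have hn' : (0 : ℝ) < n := by exact_mod_cast hn
  have h1 : a * (2 * n) = 0 := by
    rw [← K.sum_inner_P (stdOrthonormalBasis ℝ T) hT, Finset.mul_sum]
    exact Finset.sum_eq_zero fun i _ ↦ h _
  exact (mul_eq_zero.mp h1).resolve_right (by positivity)

end ContactVectorSpace

section

set_option linter.unusedSectionVars false

variable {E : Type*} [NormedAddCommGroup E] [NormedSpace ℝ E] [FiniteDimensional ℝ E]
  [CompleteSpace E] {H : Type*} [TopologicalSpace H] {I : ModelWithCorners ℝ E H}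
  {M : Type*} [TopologicalSpace M] [ChartedSpace H M] [IsManifold I ∞ M]
  [RiemannianBundle (TangentSpace I : M → Type _)]
  [IsContMDiffRiemannianBundle I ∞ E (TangentSpace I : M → Type _)]

open TopologicalSpace (Opens)

/-! ### Smoothness on open sets -/

section

variable {U : Set M} {F : M → ℝ} {X Y Z : Π x : M, TangentSpace I x}

theorem contMDiffOn_mvfderiv (hU : IsOpen U) (hF : ContMDiffOn I 𝓘(ℝ, ℝ) ∞ F U)
    (hX : CMDiff[U] ∞ (T% X)) :
    ContMDiffOn I 𝓘(ℝ, ℝ) ∞ (fun x ↦ mvfderiv I F x (X x)) U := by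
  have h1 := hF.contMDiffOn_tangentMapWithin (m := ∞) (by simp) hU.uniqueMDiffOn
  have h2 : ContMDiffOn I 𝓘(ℝ, ℝ).tangent ∞
      (fun x ↦ tangentMapWithin I 𝓘(ℝ, ℝ) F U (⟨x, X x⟩ : TangentBundle I M)) U :=
    h1.comp hX (fun x hx ↦ hx)
  have h3 := (contMDiff_snd_tangentBundle_modelSpace (n := ∞) ℝ 𝓘(ℝ, ℝ)).comp_contMDiffOn h2
  refine h3.congr fun x hx ↦ ?_
  change mfderiv I 𝓘(ℝ, ℝ) F x (X x) = mfderivWithin I 𝓘(ℝ, ℝ) F U x (X x)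
  rw [mfderivWithin_of_isOpen hU hx]

theorem contMDiffOn_inner (hX : CMDiff[U] ∞ (T% X)) (hY : CMDiff[U] ∞ (T% Y)) :
    ContMDiffOn I 𝓘(ℝ, ℝ) ∞ (fun x ↦ inner ℝ (X x) (Y x)) U :=
  ContMDiffOn.inner_bundle (F := E) (E := (TangentSpace I : M → Type _)) (b := fun y : M ↦ y)
    (IB := I) hX hY

theorem contMDiffOn_mlieBracket (hU : IsOpen U) (hX : CMDiff[U] ∞ (T% X))
    (hY : CMDiff[U] ∞ (T% Y)) : CMDiff[U] ∞ (T% (mlieBracket I X Y)) := by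
  intro x hx
  have : IsManifold I (minSmoothness ℝ 2) M := .of_le (n := ∞) (by
    rw [minSmoothness_of_isRCLikeNormedField]; exact ENat.LEInfty.out)
  have : IsManifold I (((⊤ : ℕ∞) : WithTop ℕ∞) + 1) M := .of_le (n := ∞) (by simp)
  exact (ContMDiffAt.mlieBracket_vectorField (m := ⊤) (n := ⊤)
    (hX.contMDiffAt (hU.mem_nhds hx)) (hY.contMDiffAt (hU.mem_nhds hx)) (by simp)).contMDiffWithinAt

theorem mdifferentiableAt_of_contMDiffOn (hU : IsOpen U) (hX : CMDiff[U] ∞ (T% X)) {x : M}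
    (hx : x ∈ U) : MDiffAt (T% X) x :=
  (hX.contMDiffAt (hU.mem_nhds hx)).mdifferentiableAt (by simp)

/-- A vector field with smooth inner products is smooth: in a local frame, its coefficients are
obtained from these by inverting the Gram matrix. -/
theorem contMDiffOn_of_inner (hU : IsOpen U)
    (h : ∀ (W : Set M) (Z : Π x : M, TangentSpace I x), IsOpen W → W ⊆ U → CMDiff[W] ∞ (T% Z) →
      ContMDiffOn I 𝓘(ℝ, ℝ) ∞ (fun x ↦ inner ℝ (X x) (Z x)) W) : CMDiff[U] ∞ (T% X) := by
  intro x₀ hx₀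
  let e := trivializationAt E (TangentSpace I : M → Type _) x₀
  let b := Module.finBasis ℝ E
  let s := e.localFrame b
  let W := U ∩ e.baseSet
  have hW : IsOpen W := hU.inter e.open_baseSet
  have hxW : x₀ ∈ W := ⟨hx₀, FiberBundle.mem_baseSet_trivializationAt' x₀⟩
  have hs : ∀ i, CMDiff[W] ∞ (T% (s i)) := fun i ↦
    (e.contMDiffOn_localFrame_baseSet ∞ b i).mono Set.inter_subset_right
  let Gm : M → Matrix (Fin (Module.finrank ℝ E)) (Fin (Module.finrank ℝ E)) ℝ :=
    fun x ↦ Matrix.of fun i j ↦ inner ℝ (s i x) (s j x)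
  have hG : ∀ i j, ContMDiffOn I 𝓘(ℝ, ℝ) ∞ (fun x ↦ Gm x i j) W := fun i j ↦
    contMDiffOn_inner (hs i) (hs j)
  have hdet : ∀ A : M → Matrix (Fin (Module.finrank ℝ E)) (Fin (Module.finrank ℝ E)) ℝ,
      (∀ i j, ContMDiffOn I 𝓘(ℝ, ℝ) ∞ (fun x ↦ A x i j) W) →
      ContMDiffOn I 𝓘(ℝ, ℝ) ∞ (fun x ↦ (A x).det) W := by
    intro A hA
    simp only [Matrix.det_apply']
    refine contMDiffOn_finsetSum fun σ _ ↦ ?_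
    refine contMDiffOn_const.mul (contMDiffOn_finsetProd fun i _ ↦ hA _ _)
  have hunit : ∀ x ∈ W, (Gm x).det ≠ 0 := by
    intro x hx hdet0
    obtain ⟨v, hv, hv0⟩ := Matrix.exists_mulVec_eq_zero_iff.mpr hdet0
    have hzero : ∑ j, v j • s j x = 0 := by
      have h1 : ∀ i, inner ℝ (s i x) (∑ j, v j • s j x) = (0 : ℝ) := by
        intro i
        have := congrFun hv0 i
        simpa [Gm, Matrix.mulVec, dotProduct, inner_sum, inner_smul_right, mul_comm] using this
      have h2 : inner ℝ (∑ j, v j • s j x) (∑ j, v j • s j x) = (0 : ℝ) := by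
        rw [sum_inner]
        simp [inner_smul_left, h1]
      exact inner_self_eq_zero.mp h2
    have hli := (e.isLocalFrameOn_localFrame_baseSet I ∞ b).linearIndependent hx.2
    exact hv (funext fun j ↦ Fintype.linearIndependent_iff.mp hli v hzero j)
  have hinv : ∀ i j, ContMDiffOn I 𝓘(ℝ, ℝ) ∞ (fun x ↦ (Gm x)⁻¹ i j) W := by
    intro i j
    simp only [Matrix.inv_def, Matrix.smul_apply, Ring.inverse_eq_inv', Matrix.adjugate_apply]
    refine ((hdet Gm hG).inv₀ hunit).smul (hdet _ fun k l ↦ ?_)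
    by_cases hk : k = j
    · subst hk
      simp only [Matrix.updateRow_self]
      exact contMDiffOn_const
    · simp only [Matrix.updateRow_ne hk]
      exact hG k l
  have hsum : CMDiff[W] ∞
      (T% (fun x ↦ ∑ i, (∑ j, (Gm x)⁻¹ i j * inner ℝ (X x) (s j x)) • s i x)) := by
    refine ContMDiffOn.sum_section fun i _ ↦ ContMDiffOn.smul_section ?_ (hs i)
    refine contMDiffOn_finsetSum fun j _ ↦ (hinv i j).mul ?_
    exact h W (s j) hW Set.inter_subset_left (hs j)
  have heq : ∀ x ∈ W, X x = ∑ i, (∑ j, (Gm x)⁻¹ i j * inner ℝ (X x) (s j x)) • s i x := by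
    intro x hx
    have hframe := (e.isLocalFrameOn_localFrame_baseSet I ∞ b)
    obtain ⟨c, hc⟩ : ∃ c : Fin (Module.finrank ℝ E) → ℝ, X x = ∑ i, c i • s i x :=
      ⟨_, hframe.coeff_sum_eq X hx.2⟩
    have h1 : (fun j ↦ inner ℝ (X x) (s j x)) = (Gm x).mulVec c := by
      funext j
      rw [hc, sum_inner]
      simp [Gm, Matrix.mulVec, dotProduct, inner_smul_left, real_inner_comm, mul_comm]
    have h2 : (Gm x)⁻¹.mulVec (fun j ↦ inner ℝ (X x) (s j x)) = c := by
      rw [h1, Matrix.mulVec_mulVec, Matrix.nonsing_inv_mul _ (isUnit_iff_ne_zero.mpr (hunit x hx)),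
        Matrix.one_mulVec]
    calc X x = ∑ i, c i • s i x := hc
      _ = _ := by rw [← h2]; rfl
  refine ContMDiffAt.contMDiffWithinAt ((hsum.congr fun x hx ↦ ?_).contMDiffAt (hW.mem_nhds hxW))
  rw [← heq x hx]

theorem contMDiffOn_leviCivita (hU : IsOpen U) (hX : CMDiff[U] ∞ (T% X))
    (hY : CMDiff[U] ∞ (T% Y)) : CMDiff[U] ∞ (T% (fun x ↦ leviCivita I M Y x (X x))) := by
  refine contMDiffOn_of_inner hU fun W Z hW hWU hZ ↦ ?_
  replace hX := hX.mono hWU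
  replace hY := hY.mono hWU
  have h : ContMDiffOn I 𝓘(ℝ, ℝ) ∞ (fun x ↦ 1 / 2 * koszul I Y X Z x) W := by
    refine contMDiffOn_const.mul ?_
    exact ((((contMDiffOn_mvfderiv hW (contMDiffOn_inner hY hZ) hX).add
      (contMDiffOn_mvfderiv hW (contMDiffOn_inner hX hZ) hY)).sub
      (contMDiffOn_mvfderiv hW (contMDiffOn_inner hX hY) hZ)).add
      (contMDiffOn_inner (contMDiffOn_mlieBracket hW hX hY) hZ)).sub
      (contMDiffOn_inner (contMDiffOn_mlieBracket hW hX hZ) hY) |>.sub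
      (contMDiffOn_inner (contMDiffOn_mlieBracket hW hY hZ) hX)
  refine h.congr fun x hx ↦ ?_
  exact inner_leviCivitaFun_eq (mdifferentiableAt_of_contMDiffOn hW hX hx)
    (mdifferentiableAt_of_contMDiffOn hW hY hx) (mdifferentiableAt_of_contMDiffOn hW hZ hx)

theorem mlieBracket_eq {x : M} (hX : MDiffAt (T% X) x) (hY : MDiffAt (T% Y) x) :
    mlieBracket I X Y x = leviCivita I M Y x (X x) - leviCivita I M X x (Y x) :=
  ((CovariantDerivative.torsion_eq_zero_iff _).mp (leviCivita_torsion (I := I) (M := M)) hX hY).symm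

/-- A field that is smooth near `x` agrees near `x` with a field that is smooth everywhere. -/
theorem exists_smooth_eventuallyEq [T2Space M] (hU : IsOpen U) (hX : CMDiff[U] ∞ (T% X)) {x : M}
    (hx : x ∈ U) : ∃ X' : Π x : M, TangentSpace I x, IsSmoothField I X' ∧
      ∀ᶠ y in nhds x, X' y = X y := by
  obtain ⟨f, -, hf⟩ := (SmoothBumpFunction.nhds_basis_tsupport (I := I) x).mem_iff.mp
    (hU.mem_nhds hx)
  refine ⟨(f : M → ℝ) • X, ContMDiffOn.smul_section_of_tsupport f.contMDiff.contMDiffOn hU hf hX,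
    ?_⟩
  filter_upwards [f.eventuallyEq_one] with y hy
  simp [hy]
end

/-! ### The calculus of an open set -/

section

open Classical in
/-- Extension by zero of a function on an open set. -/
def extFun {U : Opens M} (f : U → ℝ) (x : M) : ℝ := if h : x ∈ U then f ⟨x, h⟩ else 0

open Classical in
/-- Extension by zero of a vector field on an open set. -/
def extField {U : Opens M} (X : Π x : U, TangentSpace I (x : M)) (x : M) : TangentSpace I x :=
  if h : x ∈ U then X ⟨x, h⟩ else 0

variable {U : Opens M}

@[simp] theorem extFun_coe (f : U → ℝ) (x : U) : extFun f (x : M) = f x := by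
  simp [extFun]

@[simp] theorem extField_coe (X : Π x : U, TangentSpace I (x : M)) (x : U) :
    extField X (x : M) = X x := by
  simp [extField]

theorem extFun_eqOn {f : U → ℝ} {F : M → ℝ} (h : ∀ x : U, f x = F x) :
    Set.EqOn (extFun f) F U := fun x hx ↦ by
  simpa using (extFun_coe f ⟨x, hx⟩).trans (h ⟨x, hx⟩)

theorem extField_eqOn {X : Π x : U, TangentSpace I (x : M)} {X' : Π x : M, TangentSpace I x}
    (h : ∀ x : U, X x = X' x) : ∀ x ∈ U, extField X x = X' x := fun x hx ↦ by
  simpa using (extField_coe X ⟨x, hx⟩).trans (h ⟨x, hx⟩)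

theorem contMDiffOn_extFun {f : U → ℝ} {F : M → ℝ} (hF : ContMDiffOn I 𝓘(ℝ, ℝ) ∞ F U)
    (h : ∀ x : U, f x = F x) : ContMDiffOn I 𝓘(ℝ, ℝ) ∞ (extFun f) U :=
  hF.congr (extFun_eqOn h)

theorem contMDiffOn_extField {X : Π x : U, TangentSpace I (x : M)}
    {X' : Π x : M, TangentSpace I x} (hX : CMDiff[(U : Set M)] ∞ (T% X'))
    (h : ∀ x : U, X x = X' x) : CMDiff[(U : Set M)] ∞ (T% (extField X)) :=
  hX.congr fun x hx ↦ by rw [extField_eqOn h x hx]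

variable (I U) in
/-- The smooth functions on an open set. -/
def smoothFunctions : Subalgebra ℝ (U → ℝ) where
  carrier := {f | ContMDiffOn I 𝓘(ℝ, ℝ) ∞ (extFun f) U}
  mul_mem' hf hg := contMDiffOn_extFun (hf.mul hg) fun x ↦ by simp
  add_mem' hf hg := contMDiffOn_extFun (hf.add hg) fun x ↦ by simp
  algebraMap_mem' c := contMDiffOn_extFun (contMDiffOn_const (c := c)) fun x ↦ by simp

variable (I U) in
/-- The smooth vector fields on an open set. -/
def smoothFields : Submodule (smoothFunctions I U) (Π x : U, TangentSpace I (x : M)) where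
  carrier := {X | CMDiff[(U : Set M)] ∞ (T% (extField X))}
  add_mem' hX hY := contMDiffOn_extField (hX.add_section hY) fun x ↦ by simp
  zero_mem' := by
    refine (contMDiff_zeroSection ℝ (TangentSpace I : M → Type _)).contMDiffOn.congr
      fun x hx ↦ ?_
    have : extField (0 : Π x : U, TangentSpace I (x : M)) x = 0 := by
      simp [extField]
    rw [this]; rfl
  smul_mem' f X hX := contMDiffOn_extField (ContMDiffOn.smul_section f.2 hX) fun x ↦ by
    simp; rfl

theorem mdifferentiableAt_extFun (f : smoothFunctions I U) (x : U) :
    MDiffAt (extFun f.1) (x : M) :=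
  (f.2.contMDiffAt (U.2.mem_nhds x.2)).mdifferentiableAt (by simp)

theorem mdifferentiableAt_extField (X : smoothFields I U) (x : U) :
    MDiffAt (T% (extField X.1)) (x : M) :=
  mdifferentiableAt_of_contMDiffOn U.2 X.2 x.2

theorem mvfderiv_congr {F F' : M → ℝ} {x : M} (h : ∀ᶠ y in nhds x, F y = F' y) :
    mvfderiv I F x = mvfderiv I F' x := by
  ext v
  change mfderiv I 𝓘(ℝ, ℝ) F x v = mfderiv I 𝓘(ℝ, ℝ) F' x v
  rw [Filter.EventuallyEq.mfderiv_eq h]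
  rfl

/-- The Levi-Civita connection is a local operator. -/
theorem leviCivita_congr {X Y : Π x : M, TangentSpace I x} {x : M} (hX : MDiffAt (T% X) x)
    (h : ∀ᶠ y in nhds x, X y = Y y) : leviCivita I M X x = leviCivita I M Y x := by
  have hY : MDiffAt (T% Y) x := hX.congr_of_eventuallyEq (h.mono fun y hy ↦ by simp [hy])
  exact (leviCivita I M).isCovariantDerivativeOnUniv.congr_of_eventuallyEq hX hY
    Filter.univ_mem h

theorem eventually_of_open {p : M → Prop} (h : ∀ y : U, p y) (x : U) :
    ∀ᶠ y in nhds (x : M), p y :=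
  Filter.eventually_of_mem (U.2.mem_nhds x.2) fun y hy ↦ h ⟨y, hy⟩

variable (I U) in
instance : AddCommGroup (smoothFields I U) := inferInstance

variable (I U) in
instance : Module (smoothFunctions I U) (smoothFields I U) := inferInstance

variable (I U) in
instance : SMul (smoothFunctions I U) (smoothFields I U) := Module.toDistribMulAction.toSMul

/-- The derivative of a function along a field, on an open set. -/
def localD (X : smoothFields I U) (f : smoothFunctions I U) : smoothFunctions I U :=
  ⟨fun x ↦ mvfderiv I (extFun f.1) x (X.1 x),
    contMDiffOn_extFun (contMDiffOn_mvfderiv U.2 f.2 X.2) fun x ↦ by simp⟩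

/-- The metric, on an open set. -/
def localG (X Y : smoothFields I U) : smoothFunctions I U :=
  ⟨fun x ↦ inner ℝ (X.1 x) (Y.1 x),
    contMDiffOn_extFun (contMDiffOn_inner X.2 Y.2) fun x ↦ by simp⟩

/-- The Levi-Civita connection, on an open set. -/
def localNab (X Y : smoothFields I U) : smoothFields I U :=
  ⟨fun x ↦ leviCivita I M (extField Y.1) x (X.1 x),
    contMDiffOn_extField (contMDiffOn_leviCivita U.2 X.2 Y.2) fun x ↦ by simp⟩

theorem mvfderiv_extFun {f : U → ℝ} {F : M → ℝ} (h : ∀ y : U, f y = F y) (x : U) :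
    mvfderiv I (extFun f) (x : M) = mvfderiv I F (x : M) :=
  mvfderiv_congr (eventually_of_open (fun y ↦ by simpa using h y) x)

theorem leviCivita_extField (Y : smoothFields I U) {Y' : Π x : M, TangentSpace I x}
    (h : ∀ y : U, Y.1 y = Y' y) (x : U) :
    leviCivita I M (extField Y.1) (x : M) = leviCivita I M Y' (x : M) :=
  leviCivita_congr (mdifferentiableAt_extField Y x)
    (eventually_of_open (fun y ↦ by simpa using h y) x)

theorem localNab_sub_localNab (X Y : smoothFields I U) (x : U) :
    (localNab X Y - localNab Y X).1 x = mlieBracket I (extField X.1) (extField Y.1) x := by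
  rw [mlieBracket_eq (mdifferentiableAt_extField X x) (mdifferentiableAt_extField Y x)]
  simp [localNab]

theorem localNab_jacobi (X Y Z : smoothFields I U) :
    localNab X (localNab Y Z - localNab Z Y) - localNab (localNab Y Z - localNab Z Y) X
      = localNab (localNab X Y - localNab Y X) Z - localNab Z (localNab X Y - localNab Y X)
        + (localNab Y (localNab X Z - localNab Z X)
          - localNab (localNab X Z - localNab Z X) Y) := by
  have key : ∀ X Y : smoothFields I U, ∀ x : U,
      ∀ᶠ y in nhds (x : M), extField (localNab X Y - localNab Y X).1 y
        = mlieBracket I (extField X.1) (extField Y.1) y := fun X Y x ↦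
    eventually_of_open (fun y ↦ by rw [extField_coe, localNab_sub_localNab]) x
  ext x : 2
  have : IsManifold I (minSmoothness ℝ 3) M := .of_le (n := ∞) (by
    rw [minSmoothness_of_isRCLikeNormedField]; exact ENat.LEInfty.out)
  have hs : ∀ X : smoothFields I U, CMDiffAt (minSmoothness ℝ 2) (T% (extField X.1)) (x : M) :=
    fun X ↦ (X.2.contMDiffAt (U.2.mem_nhds x.2)).of_le (by
      rw [minSmoothness_of_isRCLikeNormedField]; exact ENat.LEInfty.out)
  have h := leibniz_identity_mlieBracket_apply (hs X) (hs Y) (hs Z)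
  rw [Submodule.coe_add, Pi.add_apply, localNab_sub_localNab, localNab_sub_localNab,
    localNab_sub_localNab]
  have h1 := Filter.EventuallyEq.mlieBracket_vectorField_eq (I := I)
    (Filter.EventuallyEq.refl _ (extField X.1)) (key Y Z x)
  have h2 := Filter.EventuallyEq.mlieBracket_vectorField_eq (I := I)
    (key X Y x) (Filter.EventuallyEq.refl _ (extField Z.1))
  have h3 := Filter.EventuallyEq.mlieBracket_vectorField_eq (I := I)
    (Filter.EventuallyEq.refl _ (extField Y.1)) (key X Z x)
  exact h1.trans (h.trans (congrArg₂ (· + ·) h2.symm h3.symm))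

theorem localD_apply (X : smoothFields I U) (f : smoothFunctions I U) (x : U) :
    (localD X f).1 x = mvfderiv I (extFun f.1) (x : M) (X.1 x) := rfl

theorem localG_apply (X Y : smoothFields I U) (x : U) :
    (localG X Y).1 x = inner ℝ (X.1 x) (Y.1 x) := rfl

theorem localNab_apply (X Y : smoothFields I U) (x : U) :
    (localNab X Y).1 x = leviCivita I M (extField Y.1) (x : M) (X.1 x) := rfl

theorem localD_add (X : smoothFields I U) (f f' : smoothFunctions I U) :
    localD X (f + f') = localD X f + localD X f' := by
  ext x
  change _ = (localD X f).1 x + (localD X f').1 x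
  rw [localD_apply, mvfderiv_extFun (F := extFun f.1 + extFun f'.1) (fun y ↦ by simp),
    mvfderiv_add (mdifferentiableAt_extFun f x) (mdifferentiableAt_extFun f' x)]
  rfl

theorem localD_mul (X : smoothFields I U) (f f' : smoothFunctions I U) :
    localD X (f * f') = f * localD X f' + f' * localD X f := by
  ext x
  change _ = f.1 x * (localD X f').1 x + f'.1 x * (localD X f).1 x
  rw [localD_apply, mvfderiv_extFun (F := extFun f.1 * extFun f'.1) (fun y ↦ by simp),
    mvfderiv_mul (mdifferentiableAt_extFun f x) (mdifferentiableAt_extFun f' x), extFun_coe,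
    extFun_coe]
  rfl

theorem localD_smul (X : smoothFields I U) (c : ℝ) (f : smoothFunctions I U) :
    localD X (c • f) = c • localD X f := by
  ext x
  change _ = c * (localD X f).1 x
  rw [localD_apply, mvfderiv_extFun (F := (fun _ ↦ c) * extFun f.1) (fun y ↦ by simp),
    mvfderiv_mul mdifferentiableAt_const (mdifferentiableAt_extFun f x), mvfderiv_const, smul_zero,
    add_zero]
  rfl

theorem localNab_add (X Y Z : smoothFields I U) :
    localNab X (Y + Z) = localNab X Y + localNab X Z := by
  ext x : 2
  change _ = (localNab X Y).1 x + (localNab X Z).1 x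
  rw [localNab_apply, leviCivita_extField (Y + Z) (Y' := extField Y.1 + extField Z.1)
    (fun y ↦ by simp), (leviCivita I M).isCovariantDerivativeOnUniv.add
      (mdifferentiableAt_extField Y x) (mdifferentiableAt_extField Z x)]
  rfl

theorem localNab_smul (X Y : smoothFields I U) (f : smoothFunctions I U) :
    localNab X (f • Y) = localD X f • Y + f • localNab X Y := by
  ext x : 2
  change _ = (localD X f).1 x • Y.1 x + f.1 x • (localNab X Y).1 x
  rw [localNab_apply, leviCivita_extField (f • Y) (Y' := extFun f.1 • extField Y.1)
    (fun y ↦ by simp; rfl), (leviCivita I M).isCovariantDerivativeOnUniv.leibniz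
      (mdifferentiableAt_extField Y x) (mdifferentiableAt_extFun f x), extFun_coe, extField_coe,
      localD_apply, localNab_apply, add_comm]
  rfl

theorem localD_localG (X Y Z : smoothFields I U) :
    localD X (localG Y Z) = localG (localNab X Y) Z + localG Y (localNab X Z) := by
  ext x
  have h := leviCivita_metric (mdifferentiableAt_extField X x) (mdifferentiableAt_extField Y x)
    (mdifferentiableAt_extField Z x)
  rw [extField_coe, extField_coe, extField_coe] at h
  rw [localD_apply, mvfderiv_extFun (F := fun y ↦ inner ℝ (extField Y.1 y) (extField Z.1 y))
    (fun y ↦ by simp [localG_apply]), h]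
  rfl

/-- A field that is smooth near a point agrees near the point with a smooth field on `U`. -/
theorem exists_smoothField [T2Space M] {W : Set M} (hW : IsOpen W)
    {X : Π x : M, TangentSpace I x} (hX : CMDiff[W] ∞ (T% X)) {x : M} (hx : x ∈ W) :
    ∃ X' : smoothFields I U, ∀ᶠ y in nhds x, y ∈ U → extField X'.1 y = X y := by
  obtain ⟨X', hX', h⟩ := exists_smooth_eventuallyEq hW hX hx
  refine ⟨⟨fun y ↦ X' y, contMDiffOn_extField hX'.contMDiffOn fun y ↦ rfl⟩, ?_⟩
  filter_upwards [h] with y hy hyU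
  rw [← hy]
  exact extField_eqOn (fun _ ↦ rfl) y hyU

/-- Every tangent vector is the value of a smooth field that agrees near the point with the local
extension used in the definition of the Ricci tensor. -/
theorem exists_extend [T2Space M] (x : U) (v : TangentSpace I (x : M)) :
    ∃ X : smoothFields I U, X.1 x = v ∧
      ∀ᶠ y in nhds (x : M), extField X.1 y = extend E v y := by
  obtain ⟨s, hs, h⟩ := exists_contMDiffOn_extend (k := ∞) I E (V := (TangentSpace I : M → Type _)) v
  obtain ⟨W, hWs, hW, hxW⟩ := mem_nhds_iff.mp hs
  obtain ⟨X, hX⟩ := exists_smoothField (U := U) hW (h.mono hWs) hxW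
  have h' : ∀ᶠ y in nhds (x : M), extField X.1 y = extend E v y := by
    filter_upwards [hX, U.2.mem_nhds x.2] with y hy hyU using hy hyU
  refine ⟨X, ?_, h'⟩
  have := h'.self_of_nhds
  rwa [extField_coe, extend_apply_self] at this

variable (I U) in
/-- The Riemannian calculus of an open set. -/
def calculus [T2Space M] : RiemannianCalculus (smoothFunctions I U) (smoothFields I U) where
  D :=
    { toFun := fun X ↦ Derivation.mk'
        { toFun := localD X
          map_add' := localD_add X
          map_smul' := localD_smul X }
        (localD_mul X)
      map_add' := fun X Y ↦ by
        ext f x; exact map_add (mvfderiv I (extFun f.1) (x : M)) (X.1 x) (Y.1 x)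
      map_smul' := fun f X ↦ by
        ext f' x; exact map_smul (mvfderiv I (extFun f'.1) (x : M)) (f.1 x) (X.1 x) }
  g := LinearMap.mk₂ _ localG
    (fun X Y Z ↦ by ext x; exact inner_add_left (X.1 x) (Y.1 x) (Z.1 x))
    (fun f X Y ↦ by ext x; exact real_inner_smul_left (X.1 x) (Y.1 x) (f.1 x))
    (fun X Y Z ↦ by ext x; exact inner_add_right (X.1 x) (Y.1 x) (Z.1 x))
    (fun f X Y ↦ by ext x; exact real_inner_smul_right (X.1 x) (Y.1 x) (f.1 x))
  nab :=
    { toFun := fun X ↦ AddMonoidHom.mk' (localNab X) (localNab_add X)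
      map_add' := fun X Y ↦ by
        ext Z x : 3; exact map_add (leviCivita I M (extField Z.1) (x : M)) (X.1 x) (Y.1 x)
      map_smul' := fun f X ↦ by
        ext Z x : 3; exact map_smul (leviCivita I M (extField Z.1) (x : M)) (f.1 x) (X.1 x) }
  g_symm X Y := by ext x; exact real_inner_comm (Y.1 x) (X.1 x)
  g_ext X Y h := by
    ext x : 2
    refine ext_inner_right ℝ fun v ↦ ?_
    obtain ⟨Z, hZ, -⟩ := exists_extend x v
    have := congrFun (congrArg Subtype.val (h Z)) x
    rw [← hZ]
    exact this
  nab_smul := localNab_smul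
  metric := localD_localG
  jacobi := localNab_jacobi

end

/-! ### The almost Kenmotsu structure on an open set -/

section

variable {U : Opens M}

theorem localD_eq (X : smoothFields I U) (f : smoothFunctions I U) {F : M → ℝ} {x : U}
    {v : TangentSpace I (x : M)} (hf : ∀ᶠ y in nhds (x : M), extFun f.1 y = F y)
    (hv : X.1 x = v) : (localD X f).1 x = mvfderiv I F (x : M) v := by
  rw [localD_apply, mvfderiv_congr hf, hv]

theorem localBracket_eq (X Y : smoothFields I U) {X' Y' : Π x : M, TangentSpace I x} {x : U}
    (hX : ∀ᶠ y in nhds (x : M), extField X.1 y = X' y)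
    (hY : ∀ᶠ y in nhds (x : M), extField Y.1 y = Y' y) :
    (localNab X Y - localNab Y X).1 x = mlieBracket I X' Y' x :=
  (localNab_sub_localNab X Y x).trans (Filter.EventuallyEq.mlieBracket_vectorField_eq hX hY)

theorem value_eq {X : smoothFields I U} {X' : Π x : M, TangentSpace I x} {x : U}
    (h : ∀ᶠ y in nhds (x : M), extField X.1 y = X' y) : X.1 x = X' x := by
  simpa using h.self_of_nhds

/-- Near a point, a smooth field on `U` agrees with one that is smooth on the whole manifold. -/
theorem exists_global [T2Space M] (X : smoothFields I U) (x : U) :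
    ∃ X' : Π x : M, TangentSpace I x, IsSmoothField I X' ∧
      ∀ᶠ y in nhds (x : M), extField X.1 y = X' y := by
  obtain ⟨X', hX', hX⟩ := exists_smooth_eventuallyEq U.2 X.2 x.2
  exact ⟨X', hX', hX.mono fun y hy ↦ hy.symm⟩

/-- The curvature in the calculus of an open set is the curvature of the manifold. -/
theorem calculus_curv_apply [T2Space M] (X Y Z : smoothFields I U)
    {X' Y' Z' : Π x : M, TangentSpace I x} {x : U}
    (hX : ∀ᶠ y in nhds (x : M), extField X.1 y = X' y)
    (hY : ∀ᶠ y in nhds (x : M), extField Y.1 y = Y' y)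
    (hZ : ∀ᶠ y in nhds (x : M), extField Z.1 y = Z' y) :
    ((calculus I U).curv X Y Z).1 x = curvature X' Y' Z' x := by
  have hnab : ∀ {X : smoothFields I U} {X' : Π x : M, TangentSpace I x},
      (∀ᶠ y in nhds (x : M), extField X.1 y = X' y) →
      ∀ᶠ y in nhds (x : M), extField (localNab X Z).1 y = leviCivita I M Z' y (X' y) := by
    intro X X' hX
    filter_upwards [hX, hZ.eventually_nhds, U.2.mem_nhds x.2] with y hy hy' hyU
    rw [extField_eqOn (X' := fun y ↦ leviCivita I M (extField Z.1) y (extField X.1 y))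
      (fun y ↦ by rw [localNab_apply, extField_coe]) y hyU, hy,
      leviCivita_congr (mdifferentiableAt_extField Z ⟨y, hyU⟩) hy']
  have h1 : ((calculus I U).br X Y).1 x = mlieBracket I X' Y' x := localBracket_eq X Y hX hY
  change (localNab X (localNab Y Z)).1 x - (localNab Y (localNab X Z)).1 x
    - (localNab ((calculus I U).br X Y) Z).1 x = _
  rw [localNab_apply, localNab_apply, localNab_apply, h1, value_eq hX, value_eq hY,
    leviCivita_congr (mdifferentiableAt_extField _ x) (hnab hX),
    leviCivita_congr (mdifferentiableAt_extField _ x) (hnab hY),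
    leviCivita_congr (mdifferentiableAt_extField _ x) hZ]
  rfl

namespace AlmostContactMetric

variable (S : AlmostContactMetric I M) {κ μ : M → ℝ}

theorem contMDiffOn_phi {W : Set M} {X : Π x : M, TangentSpace I x} (hX : CMDiff[W] ∞ (T% X)) :
    CMDiff[W] ∞ (T% (S.phiField X)) := fun x hx ↦
  ContMDiffWithinAt.clm_bundle_apply (F₁ := E) (F₂ := E) (b := fun y : M ↦ y)
    (E₁ := (TangentSpace I : M → Type _)) (E₂ := (TangentSpace I : M → Type _))
    (S.contMDiff_phi.contMDiffAt.contMDiffWithinAt) (hX x hx)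

theorem contMDiffOn_h {W : Set M} (hW : IsOpen W) {X : Π x : M, TangentSpace I x}
    (hX : CMDiff[W] ∞ (T% X)) : CMDiff[W] ∞ (T% (S.h X)) := by
  have hξ : CMDiff[W] ∞ (T% S.xi) := S.smooth_xi.contMDiffOn
  exact ContMDiffOn.const_smul_section
    ((contMDiffOn_mlieBracket hW hξ (S.contMDiffOn_phi hX)).sub_section
      (S.contMDiffOn_phi (contMDiffOn_mlieBracket hW hξ hX)))

theorem h_congr {X Y : Π x : M, TangentSpace I x} {x : M} (h : ∀ᶠ y in nhds x, X y = Y y) :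
    S.h X x = S.h Y x := by
  have h1 : ∀ᶠ y in nhds x, S.phiField X y = S.phiField Y y :=
    h.mono fun y hy ↦ by rw [phiField, hy]; rfl
  rw [AlmostContactMetric.h, AlmostContactMetric.h,
    Filter.EventuallyEq.mlieBracket_vectorField_eq (Filter.EventuallyEq.refl _ S.xi) h1,
    Filter.EventuallyEq.mlieBracket_vectorField_eq (Filter.EventuallyEq.refl _ S.xi) h]

theorem phi_xi (x : M) : S.phi x (S.xi x) = 0 := by
  have h := S.inner_phi_phi x (S.xi x) (S.xi x)
  rw [S.eta_eq, S.inner_xi_xi, mul_one, sub_self] at h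
  exact inner_self_eq_zero.mp h

variable (U) in
/-- The Reeb field on an open set. -/
def localXi : smoothFields I U :=
  ⟨fun x ↦ S.xi x, contMDiffOn_extField S.smooth_xi.contMDiffOn fun _ ↦ rfl⟩

variable (U) in
/-- The structure tensor on an open set. -/
def localPhi : smoothFields I U →ₗ[smoothFunctions I U] smoothFields I U where
  toFun X := ⟨fun x ↦ S.phi x (X.1 x), contMDiffOn_extField (S.contMDiffOn_phi X.2) fun x ↦ by
    rw [phiField, extField_coe]⟩
  map_add' X Y := by ext x : 2; exact map_add (S.phi x) (X.1 x) (Y.1 x)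
  map_smul' f X := by ext x : 2; exact map_smul (S.phi x) (f.1 x) (X.1 x)

/-- The operator `h` on an open set. -/
def localH (X : smoothFields I U) : smoothFields I U :=
  ⟨fun x ↦ S.h (extField X.1) x, contMDiffOn_extField (S.contMDiffOn_h U.2 X.2) fun _ ↦ rfl⟩

theorem localPhi_apply (X : smoothFields I U) (x : U) :
    (S.localPhi U X).1 x = S.phi x (X.1 x) := rfl

theorem localH_apply (X : smoothFields I U) (x : U) :
    (S.localH X).1 x = S.h (extField X.1) x := rfl

theorem extField_localXi : ∀ x ∈ U, extField (S.localXi U).1 x = S.xi x :=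
  extField_eqOn fun _ ↦ rfl

theorem eventually_xi (x : U) :
    ∀ᶠ y in nhds (x : M), extField (S.localXi U).1 y = S.xi y :=
  Filter.eventually_of_mem (U.2.mem_nhds x.2) S.extField_localXi

theorem eventually_phi {X : smoothFields I U} (x : U) :
    ∀ᶠ y in nhds (x : M), extField (S.localPhi U X).1 y = S.phiField (extField X.1) y :=
  eventually_of_open (fun y ↦ by rw [phiField, extField_coe, extField_coe]; rfl) x

theorem eventually_eta {X : smoothFields I U} {X' : Π x : M, TangentSpace I x} {x : U}
    (hX : ∀ᶠ y in nhds (x : M), extField X.1 y = X' y) :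
    ∀ᶠ y in nhds (x : M), extFun (localG X (S.localXi U)).1 y = S.eta y (X' y) := by
  filter_upwards [hX, U.2.mem_nhds x.2] with y hy hyU
  rw [← hy, S.eta_eq]
  exact (extFun_coe _ ⟨y, hyU⟩).trans (by rw [localG_apply, ← extField_coe X.1 ⟨y, hyU⟩]; rfl)

theorem eventually_fundForm {X Y : smoothFields I U} {X' Y' : Π x : M, TangentSpace I x} {x : U}
    (hX : ∀ᶠ y in nhds (x : M), extField X.1 y = X' y)
    (hY : ∀ᶠ y in nhds (x : M), extField Y.1 y = Y' y) :
    ∀ᶠ y in nhds (x : M), extFun (localG X (S.localPhi U Y)).1 y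
      = S.fundForm y (X' y) (Y' y) := by
  filter_upwards [hX, hY, U.2.mem_nhds x.2] with y hy hy' hyU
  rw [← hy, ← hy', fundForm]
  exact (extFun_coe _ ⟨y, hyU⟩).trans (by
    rw [localG_apply, localPhi_apply, ← extField_coe X.1 ⟨y, hyU⟩, ← extField_coe Y.1 ⟨y, hyU⟩])

theorem local_dEta [T2Space M] (hS : S.IsAlmostKenmotsu) (X Y : smoothFields I U) :
    localD X (localG Y (S.localXi U)) - localD Y (localG X (S.localXi U))
      - localG (localNab X Y - localNab Y X) (S.localXi U) = 0 := by
  ext x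
  obtain ⟨X', hX', hX⟩ := exists_global X x
  obtain ⟨Y', hY', hY⟩ := exists_global Y x
  have h := hS.dEta_eq_zero X' Y' hX' hY' x
  rw [dEta, S.eta_eq, ← localBracket_eq X Y hX hY, ← value_eq hX, ← value_eq hY,
    ← localD_eq X (localG Y (S.localXi U)) (S.eventually_eta hY) rfl,
    ← localD_eq Y (localG X (S.localXi U)) (S.eventually_eta hX) rfl] at h
  exact h

theorem local_dFundForm [T2Space M] (hS : S.IsAlmostKenmotsu) (X Y Z : smoothFields I U) :
    localD X (localG Y (S.localPhi U Z)) + localD Y (localG Z (S.localPhi U X))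
      + localD Z (localG X (S.localPhi U Y))
      - localG (localNab X Y - localNab Y X) (S.localPhi U Z)
      - localG (localNab Y Z - localNab Z Y) (S.localPhi U X)
      - localG (localNab Z X - localNab X Z) (S.localPhi U Y)
    = 2 * (localG X (S.localXi U) * localG Y (S.localPhi U Z)
      + localG Y (S.localXi U) * localG Z (S.localPhi U X)
      + localG Z (S.localXi U) * localG X (S.localPhi U Y)) := by
  ext x
  obtain ⟨X', hX', hX⟩ := exists_global X x
  obtain ⟨Y', hY', hY⟩ := exists_global Y x
  obtain ⟨Z', hZ', hZ⟩ := exists_global Z x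
  have h := hS.dFundForm_eq X' Y' Z' hX' hY' hZ' x
  simp only [dFundForm, etaWedgeFundForm, S.eta_eq] at h
  rw [← localBracket_eq X Y hX hY, ← localBracket_eq Y Z hY hZ, ← localBracket_eq Z X hZ hX,
    ← value_eq hX, ← value_eq hY, ← value_eq hZ,
    ← localD_eq X (localG Y (S.localPhi U Z)) (S.eventually_fundForm hY hZ) rfl,
    ← localD_eq Y (localG Z (S.localPhi U X)) (S.eventually_fundForm hZ hX) rfl,
    ← localD_eq Z (localG X (S.localPhi U Y)) (S.eventually_fundForm hX hY) rfl] at h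
  exact h

theorem two_smul_localH (X : smoothFields I U) :
    (2 : smoothFunctions I U) • S.localH X
      = localNab (S.localXi U) (S.localPhi U X) - localNab (S.localPhi U X) (S.localXi U)
        - S.localPhi U (localNab (S.localXi U) X - localNab X (S.localXi U)) := by
  ext x : 2
  change (2 : ℝ) • (S.localH X).1 x = (localNab (S.localXi U) (S.localPhi U X)
    - localNab (S.localPhi U X) (S.localXi U)).1 x
    - S.phi x ((localNab (S.localXi U) X - localNab X (S.localXi U)).1 x)
  rw [localBracket_eq _ _ (S.eventually_xi x) (S.eventually_phi x),
    localBracket_eq _ _ (S.eventually_xi x) (Filter.Eventually.of_forall fun _ ↦ rfl),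
    localH_apply, AlmostContactMetric.h, smul_smul]
  norm_num

theorem local_nullity [T2Space M] {k m : smoothFunctions I U} (hk : ∀ x, k.1 x = κ x)
    (hm : ∀ x, m.1 x = μ x) (hS : S.InNullityDistribution κ μ) (X Y : smoothFields I U) :
    (calculus I U).curv X Y (S.localXi U)
      = k • (localG Y (S.localXi U) • X - localG X (S.localXi U) • Y)
        + m • (localG Y (S.localXi U) • S.localH X - localG X (S.localXi U) • S.localH Y) := by
  ext x : 2
  obtain ⟨X', hX', hX⟩ := exists_global X x
  obtain ⟨Y', hY', hY⟩ := exists_global Y x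
  have h := hS X' Y' hX' hY' x
  rw [← calculus_curv_apply X Y (S.localXi U) hX hY (S.eventually_xi x), S.eta_eq, S.eta_eq,
    ← S.h_congr hX, ← S.h_congr hY, ← value_eq hX, ← value_eq hY] at h
  rw [h, ← hk, ← hm]
  rfl

variable (U) in
/-- The calculus of an open subset of a generalized `(κ, μ)`-almost Kenmotsu manifold. -/
def localCalculus [T2Space M] (hS : S.IsGeneralizedKappaMu κ μ) :
    KappaMuCalculus (smoothFunctions I U) (smoothFields I U) where
  toRiemannianCalculus := calculus I U
  φ := S.localPhi U
  ξ := S.localXi U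
  h := S.localH
  κ := ⟨fun x ↦ κ x, contMDiffOn_extFun hS.smooth_kappa.contMDiffOn fun _ ↦ rfl⟩
  μ := ⟨fun x ↦ μ x, contMDiffOn_extFun hS.smooth_mu.contMDiffOn fun _ ↦ rfl⟩
  g_ξ_ξ := by ext x; exact S.inner_xi_xi x
  φ_φ X := by ext x : 2; exact (S.phi_phi x (X.1 x)).trans (by rw [S.eta_eq]; rfl)
  g_φ_φ X Y := by
    ext x; exact (S.inner_phi_phi x (X.1 x) (Y.1 x)).trans (by rw [S.eta_eq, S.eta_eq]; rfl)
  φ_ξ := by ext x : 2; exact S.phi_xi x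
  dEta := S.local_dEta hS.almostKenmotsu
  dFundForm := S.local_dFundForm hS.almostKenmotsu
  two_h := S.two_smul_localH
  nullity := S.local_nullity (fun _ ↦ rfl) (fun _ ↦ rfl) hS.nullity

end AlmostContactMetric

end

/-! ### The almost Kenmotsu structure on tangent spaces -/

section

variable {U : Opens M}

variable (I) in
/-- Evaluation of functions at a point. -/
def evalAt (x : U) : smoothFunctions I U →+* ℝ :=
  (Pi.evalRingHom _ x).comp (smoothFunctions I U).val.toRingHom

theorem evalAt_apply (x : U) (f : smoothFunctions I U) : evalAt I x f = f.1 x := rfl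

namespace AlmostContactMetric

variable [T2Space M] (S : AlmostContactMetric I M) {κ μ : M → ℝ}

/-- The trace-free part of the shape operator, on a tangent space. -/
def traceFreeShape (x : M) : TangentSpace I x →ₗ[ℝ] TangentSpace I x where
  toFun v := leviCivita I M S.xi x v - (v - (inner ℝ v (S.xi x) : ℝ) • S.xi x)
  map_add' v w := by rw [map_add, inner_add_left]; module
  map_smul' c v := by rw [map_smul, real_inner_smul_left, RingHom.id_apply]; module

variable (hS : S.IsGeneralizedKappaMu κ μ)

/-- The shape operator `A` of the calculus is a tensor. -/
theorem nab_ξ_apply (X : smoothFields I U) (x : U) :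
    ((calculus I U).nab X (S.localXi U)).1 x = leviCivita I M S.xi x (X.1 x) := by
  change leviCivita I M _ _ _ = _
  rw [leviCivita_extField (S.localXi U) (Y' := S.xi) (fun _ ↦ rfl)]

theorem B_apply (X : smoothFields I U) (x : U) :
    ((S.localCalculus U hS).B X).1 x = S.traceFreeShape x (X.1 x) := by
  change ((calculus I U).nab X (S.localXi U)).1 x - _ = _
  rw [nab_ξ_apply]
  rfl

theorem φ_apply (X : smoothFields I U) (x : U) :
    ((S.localCalculus U hS).φ X).1 x = S.phi x (X.1 x) := rfl

theorem inner_phi_left (hS : S.IsGeneralizedKappaMu κ μ) (x : U) (v w : TangentSpace I (x : M)) :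
    (inner ℝ (S.phi x v) w : ℝ) = -inner ℝ v (S.phi x w) := by
  obtain ⟨X, rfl, -⟩ := exists_extend x v
  obtain ⟨Y, rfl, -⟩ := exists_extend x w
  exact congrArg (evalAt I x) ((S.localCalculus U hS).g_φ_left X Y)

theorem inner_traceFreeShape_left (hS : S.IsGeneralizedKappaMu κ μ) (x : U)
    (v w : TangentSpace I (x : M)) :
    (inner ℝ (S.traceFreeShape x v) w : ℝ) = inner ℝ v (S.traceFreeShape x w) := by
  obtain ⟨X, rfl, -⟩ := exists_extend x v
  obtain ⟨Y, rfl, -⟩ := exists_extend x w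
  have h := congrArg (evalAt I x) ((S.localCalculus U hS).g_B_left X Y)
  rw [← S.B_apply hS, ← S.B_apply hS]
  exact h

theorem traceFreeShape_xi (hS : S.IsGeneralizedKappaMu κ μ) (x : U) :
    S.traceFreeShape x (S.xi x) = 0 := by
  have h := congrArg (fun X : smoothFields I U ↦ X.1 x) (S.localCalculus U hS).B_ξ
  exact (S.B_apply hS _ x).symm.trans h

theorem traceFreeShape_phi (hS : S.IsGeneralizedKappaMu κ μ) (x : U) (v : TangentSpace I (x : M)) :
    S.traceFreeShape x (S.phi x v) = -S.phi x (S.traceFreeShape x v) := by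
  obtain ⟨X, rfl, -⟩ := exists_extend x v
  have h := congrArg (fun X : smoothFields I U ↦ X.1 x) ((S.localCalculus U hS).B_φ X)
  rw [← φ_apply S hS, ← S.B_apply hS, ← S.B_apply hS, ← φ_apply S hS]
  exact h

theorem traceFreeShape_traceFreeShape (hS : S.IsGeneralizedKappaMu κ μ) (x : U)
    (v : TangentSpace I (x : M)) :
    S.traceFreeShape x (S.traceFreeShape x v)
      = (-(κ x + 1)) • (v - (inner ℝ v (S.xi x) : ℝ) • S.xi x) := by
  obtain ⟨X, rfl, -⟩ := exists_extend x v
  have h := congrArg (fun X : smoothFields I U ↦ X.1 x) ((S.localCalculus U hS).B_B X)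
  rw [← S.B_apply hS, ← S.B_apply hS]
  exact h

variable (κ) in
/-- The tangent space at a point of a generalized `(κ, μ)`-almost Kenmotsu manifold. Its laws are
the values at the point of those of the calculus of the whole manifold. -/
def contactVectorSpace (x : M) : ContactVectorSpace (TangentSpace I x) where
  ξ := S.xi x
  φ := (S.phi x).toLinearMap
  B := S.traceFreeShape x
  s := -(κ x + 1)
  inner_ξ_ξ := S.inner_xi_xi x
  φ_φ v := (S.phi_phi x v).trans (by rw [S.eta_eq])
  inner_φ_left := S.inner_phi_left hS (⟨x, trivial⟩ : (⊤ : Opens M))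
  inner_B_left := S.inner_traceFreeShape_left hS (⟨x, trivial⟩ : (⊤ : Opens M))
  B_ξ := S.traceFreeShape_xi hS (⟨x, trivial⟩ : (⊤ : Opens M))
  B_φ := S.traceFreeShape_phi hS (⟨x, trivial⟩ : (⊤ : Opens M))
  B_B := S.traceFreeShape_traceFreeShape hS (⟨x, trivial⟩ : (⊤ : Opens M))

theorem A_apply (X : smoothFields I U) (x : U) :
    ((S.localCalculus U hS).A X).1 x = (S.contactVectorSpace κ hS x).A (X.1 x) := by
  refine (S.nab_ξ_apply X x).trans ?_
  exact (sub_add_cancel _ _).symm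

variable {n : ℕ}

theorem m_apply (X Y : smoothFields I U) (x : U) :
    ((S.localCalculus U hS).m X Y).1 x
      = inner ℝ ((S.contactVectorSpace κ hS x).m (κ x) (μ x) (X.1 x)) (Y.1 x) := by
  rw [ContactVectorSpace.m_apply, inner_add_left, real_inner_smul_left, real_inner_smul_left]
  change _ = _ + μ x * inner ℝ (S.phi x (S.traceFreeShape x (X.1 x))) (Y.1 x)
  rw [← S.B_apply hS]
  rfl

theorem exists_horizontal (x : U) (v : TangentSpace I (x : M))
    (hv : inner ℝ v (S.xi x) = (0 : ℝ)) : ∃ X : smoothFields I U,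
      (S.localCalculus U hS).g X (S.localCalculus U hS).ξ = 0 ∧ X.1 x = v := by
  obtain ⟨X, hX, -⟩ := exists_extend x v
  refine ⟨(S.localCalculus U hS).P X, (S.localCalculus U hS).g_P_ξ X, ?_⟩
  change X.1 x - (inner ℝ (X.1 x) (S.xi x) : ℝ) • S.xi x = v
  rw [hX, hv, zero_smul, sub_zero]

/-- On the open set where `s` does not vanish, `s` is constant along the contact distribution. -/
theorem D_s_eq_zero (hn : 1 < n) (hE : Module.finrank ℝ E = 2 * n + 1)
    (hs : IsUnit (S.localCalculus U hS).s) (X : smoothFields I U)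
    (hX : (S.localCalculus U hS).g X (S.localCalculus U hS).ξ = 0) :
    (S.localCalculus U hS).D X (S.localCalculus U hS).s = 0 := by
  ext x
  have hsx : (S.contactVectorSpace κ hS x).s ≠ 0 := (hs.map (evalAt I x)).ne_zero
  refine (S.contactVectorSpace κ hS x).eq_zero_of_relation hn hE hsx
    (mvfderiv I (extFun (S.localCalculus U hS).s.1) (x : M)).toLinearMap ?_
    (congrFun (congrArg Subtype.val hX) x)
  intro a b c ha hb hc
  obtain ⟨X, hX, rfl⟩ := S.exists_horizontal hS x a ha
  obtain ⟨Y, hY, rfl⟩ := S.exists_horizontal hS x b hb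
  obtain ⟨Z, hZ, rfl⟩ := S.exists_horizontal hS x c hc
  have h := congrArg (evalAt I x) ((S.localCalculus U hS).D_s_relation hX hY hZ)
  change _ * _ - _ * inner ℝ (S.traceFreeShape x (Y.1 x)) _
    = _ * _ - _ * inner ℝ (S.traceFreeShape x (X.1 x)) _
  change mvfderiv I _ (x : M) (S.traceFreeShape x (Y.1 x)) * _ - _
    = mvfderiv I _ (x : M) (S.traceFreeShape x (X.1 x)) * _ - _
  rw [← S.B_apply hS, ← S.B_apply hS]
  exact h

/-- The Ricci tensor, where `s` does not vanish. -/
theorem ricci_eq_inner (hn : 1 < n) (hE : Module.finrank ℝ E = 2 * n + 1)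
    (hs : IsUnit (S.localCalculus U hS).s) (x : U) (v w : TangentSpace I (x : M)) :
    ricci (I := I) (x : M) v w = 2 * inner ℝ ((S.contactVectorSpace κ hS x).B v) w
      - 2 * n * inner ℝ ((S.contactVectorSpace κ hS x).A v) w
      + μ x * inner ℝ (S.phi x ((S.contactVectorSpace κ hS x).B v)) w
      + 2 * n * κ x * (inner ℝ v (S.xi x) * inner ℝ w (S.xi x)) := by
  refine Eq.trans (Finset.sum_congr rfl fun i _ ↦ ?_) ((S.contactVectorSpace κ hS x).sum_curvature
    (stdOrthonormalBasis ℝ (TangentSpace I (x : M))) hE (κ := κ x) rfl (μ x) v w)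
  obtain ⟨X, hXv, hX⟩ := exists_extend x (stdOrthonormalBasis ℝ (TangentSpace I (x : M)) i)
  obtain ⟨Y, hYv, hY⟩ := exists_extend x v
  obtain ⟨Z, hZv, hZ⟩ := exists_extend x w
  rw [← calculus_curv_apply X Y Z hX hY hZ, ← hXv, ← hYv, ← hZv]
  have h := congrArg (evalAt I x)
    ((S.localCalculus U hS).g_curv hs (S.D_s_eq_zero hS hn hE hs) X Y Z X)
  simp only [map_sub, map_add, map_mul] at h
  rw [← S.A_apply hS, ← S.A_apply hS, ← S.m_apply hS, ← S.m_apply hS, ← S.m_apply hS,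
    ← S.m_apply hS]
  exact h

theorem ricci_eq (hn : 1 < n) (hE : Module.finrank ℝ E = 2 * n + 1)
    (hs : IsUnit (S.localCalculus U hS).s) (X Y : smoothFields I U) (x : U) :
    ricci (I := I) (x : M) (X.1 x) (Y.1 x) = ((S.localCalculus U hS).ric n X Y).1 x := by
  rw [S.ricci_eq_inner hS hn hE hs, ← S.A_apply hS, ← evalAt_apply, KappaMuCalculus.ric]
  simp only [map_sub, map_add, map_mul, map_natCast, map_ofNat]
  change 2 * inner ℝ (S.traceFreeShape x (X.1 x)) _ - _
    + μ x * inner ℝ (S.phi x (S.traceFreeShape x (X.1 x))) _ + _ = _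
  rw [← S.B_apply hS]
  rfl

theorem scalarCurvature_eq (hn : 1 < n) (hE : Module.finrank ℝ E = 2 * n + 1)
    (hs : IsUnit (S.localCalculus U hS).s) (x : U) :
    scalarCurvature I (x : M) = 2 * n * κ x - 4 * n ^ 2 := by
  simp only [scalarCurvature, S.ricci_eq_inner hS hn hE hs]
  exact (S.contactVectorSpace κ hS x).sum_ricci
    (stdOrthonormalBasis ℝ (TangentSpace I (x : M))) hE (κ x) (μ x)

end AlmostContactMetric
end

/-! ### The critical point equation on the manifold -/

section

variable {U : Opens M}

/-- A smooth function without zeros is invertible among the smooth functions. -/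
theorem isUnit_of_ne_zero {f : smoothFunctions I U} (hf : ∀ x, f.1 x ≠ 0) : IsUnit f := by
  refine IsUnit.of_mul_eq_one ⟨fun x ↦ (f.1 x)⁻¹, contMDiffOn_extFun
    (ContMDiffOn.inv₀ f.2 fun x hx ↦ ?_) fun x ↦ by rw [extFun_coe]⟩ ?_
  · have := hf ⟨x, hx⟩
    rwa [← extFun_coe f.1 ⟨x, hx⟩] at this
  · ext x
    exact mul_inv_cancel₀ (hf x)

theorem inner_gradient (f : M → ℝ) (x : M) (v : TangentSpace I x) :
    inner ℝ (gradient I f x) v = mvfderiv I f x v := by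
  have : CompleteSpace (TangentSpace I x) := FiniteDimensional.complete ℝ _
  simp [gradient]

theorem contMDiffOn_gradient {f : M → ℝ} (hf : ContMDiff I 𝓘(ℝ, ℝ) ∞ f) :
    CMDiff[(U : Set M)] ∞ (T% (gradient I f)) :=
  contMDiffOn_of_inner U.2 fun _ Z hW _ hZ ↦
    (contMDiffOn_mvfderiv hW hf.contMDiffOn hZ).congr fun x _ ↦ inner_gradient f x (Z x)

/-- The trace of the critical point equation: `dim M = 2 n + 1` gives `2 n Δ f = - r f`. -/
theorem SatisfiesCPE.laplacian_eq {n : ℕ} (hE : Module.finrank ℝ E = 2 * n + 1) {f : M → ℝ}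
    (h : SatisfiesCPE I f) (x : M) : 2 * n * laplacian I f x = -(f x * scalarCurvature I x) := by
  have h1 := Finset.sum_congr (s₁ := Finset.univ) rfl fun i _ ↦
    h x (stdOrthonormalBasis ℝ (TangentSpace I x) i) (stdOrthonormalBasis ℝ (TangentSpace I x) i)
  have h2 : (Module.finrank ℝ E : ℝ) = 2 * n + 1 := by exact_mod_cast hE
  have h3 : (Module.finrank ℝ (TangentSpace I x) : ℝ) = 2 * n + 1 := h2
  have h4 : (2 * (n : ℝ) + 1) ≠ 0 := by positivity
  simp only [linScalarAdjoint, tracelessRicci, Finset.sum_add_distrib, Finset.sum_sub_distrib,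
    ← Finset.mul_sum, ContactVectorSpace.sum_inner_self] at h1
  rw [h2, h3, div_mul_cancel₀ _ h4] at h1
  simp only [laplacian, scalarCurvature] at h1 ⊢
  linarith

/-- The critical point equation, with the Laplacian eliminated by its trace. -/
theorem SatisfiesCPE.hessian_eq {n : ℕ} (hn : 0 < n) (hE : Module.finrank ℝ E = 2 * n + 1)
    {f : M → ℝ} (h : SatisfiesCPE I f) (x : M) (v w : TangentSpace I x) :
    hessian f x v w = (f x + 1) * ricci x v w
      - (f x / (2 * n) + 1 / (2 * n + 1)) * scalarCurvature I x * inner ℝ v w := by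
  have h1 := h x v w
  have h2 := h.laplacian_eq hE x
  have h3 : (Module.finrank ℝ E : ℝ) = 2 * n + 1 := by exact_mod_cast hE
  have hn' : (0 : ℝ) < n := by exact_mod_cast hn
  have h4 : laplacian I f x = -(f x * scalarCurvature I x) / (2 * n) := by
    rw [← h2]; field_simp
  rw [linScalarAdjoint, tracelessRicci, h3, h4] at h1
  linear_combination h1

namespace AlmostContactMetric

variable [T2Space M] (S : AlmostContactMetric I M) {κ μ : M → ℝ} {n : ℕ}
  (hS : S.IsGeneralizedKappaMu κ μ)

theorem eq_zero_of_mul_g_P (hn : 0 < n) (hE : Module.finrank ℝ E = 2 * n + 1)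
    {a : smoothFunctions I U} (ha : ∀ X, a * (S.localCalculus U hS).g
      ((S.localCalculus U hS).P X) X = 0) : a = 0 := by
  ext x
  refine (S.contactVectorSpace κ hS x).eq_zero_of_mul_inner_P hn hE fun v ↦ ?_
  obtain ⟨X, rfl, -⟩ := exists_extend x v
  exact congrArg (evalAt I x) (ha X)

theorem kappa_le_neg_one (hS : S.IsGeneralizedKappaMu κ μ) (hn : 0 < n)
    (hE : Module.finrank ℝ E = 2 * n + 1) (x : M) :
    κ x ≤ -1 := by
  have h : 0 ≤ -(κ x + 1) := (S.contactVectorSpace κ hS x).s_nonneg hn hE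
  linarith

/-- At a point where `s = -(κ + 1)` is zero, `B` is zero, and so is `h = φ B`. -/
theorem h_eq_zero (hS : S.IsGeneralizedKappaMu κ μ) {x : M} (hx : κ x + 1 = 0)
    {X : Π x : M, TangentSpace I x}
    (hX : IsSmoothField I X) : S.h X x = 0 := by
  let p : (⊤ : Opens M) := ⟨x, trivial⟩
  let Y : smoothFields I (⊤ : Opens M) :=
    ⟨fun y ↦ X y, contMDiffOn_extField hX.contMDiffOn fun _ ↦ rfl⟩
  have h1 : S.h (extField Y.1) x = S.h X x :=
    S.h_congr (eventually_of_open (U := ⊤) (fun y ↦ extField_coe Y.1 y) p)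
  have h2 := congrArg (fun X : smoothFields I (⊤ : Opens M) ↦ X.1 p)
    ((S.localCalculus ⊤ hS).h_eq Y)
  have h3 : ((S.localCalculus ⊤ hS).B Y).1 p = 0 := by
    rw [B_apply]
    exact (S.contactVectorSpace κ hS x).B_eq_zero (by
      change -(κ x + 1) = 0
      rw [hx, neg_zero]) _
  rw [← h1]
  refine h2.trans ?_
  change S.phi x (((S.localCalculus ⊤ hS).B Y).1 p) = 0
  rw [h3, map_zero]

/-- The data of a solution of the critical point equation, on an open set on which `s` does not
vanish: the function `u = λ + 1`, its gradient `G`, and the coefficient `f` of the metric in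
`Hess λ = u Ric + f g`. -/
theorem exists_solution_data (hn : 1 < n) (hE : Module.finrank ℝ E = 2 * n + 1)
    (hs : IsUnit (S.localCalculus U hS).s) {lam : M → ℝ} (hlam : ContMDiff I 𝓘(ℝ, ℝ) ∞ lam)
    (h : SatisfiesCPE I lam) :
    ∃ (u f : smoothFunctions I U) (G : smoothFields I U), (∀ x, u.1 x = lam x + 1) ∧
      (∀ X, (S.localCalculus U hS).g G X = (S.localCalculus U hS).D X u) ∧
      (∀ X Y, (S.localCalculus U hS).g ((S.localCalculus U hS).nab X G) Y
        = u * (S.localCalculus U hS).ric n X Y + f * (S.localCalculus U hS).g X Y) ∧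
      (2 * n * (2 * n + 1)) * f = - (2 * n + 1) * (S.localCalculus U hS).scal n * (u - 1)
        - 2 * n * (S.localCalculus U hS).scal n := by
  have hn' : (0 : ℝ) < n := by exact_mod_cast (zero_lt_one.trans hn)
  let l : smoothFunctions I U := ⟨fun x ↦ lam x, contMDiffOn_extFun hlam.contMDiffOn fun _ ↦ rfl⟩
  let G : smoothFields I U :=
    ⟨fun x ↦ gradient I lam x, contMDiffOn_extField (contMDiffOn_gradient hlam) fun _ ↦ rfl⟩
  have hscal : ∀ x : U, scalarCurvature I (x : M)
      = evalAt I x ((S.localCalculus U hS).scal n) := fun x ↦ by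
    rw [S.scalarCurvature_eq hS hn hE hs, KappaMuCalculus.scal]
    simp only [map_sub, map_mul, map_pow, map_natCast, map_ofNat]
    rfl
  refine ⟨l + 1, -((1 / (2 * n) : ℝ) • l + algebraMap ℝ _ (1 / (2 * n + 1)))
    * (S.localCalculus U hS).scal n, G, fun x ↦ rfl, fun X ↦ ?_, fun X Y ↦ ?_, ?_⟩
  · rw [map_add, Derivation.map_one_eq_zero, add_zero]
    ext x
    refine (inner_gradient lam x (X.1 x)).trans ?_
    rw [← mvfderiv_extFun (f := l.1) (fun _ ↦ rfl)]
    rfl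
  · ext x
    have h1 := h.hessian_eq (zero_lt_one.trans hn) hE x (X.1 x) (Y.1 x)
    rw [hessian, ← leviCivita_extField G (fun _ ↦ rfl), S.ricci_eq hS hn hE hs, hscal] at h1
    refine h1.trans ?_
    change (lam x + 1) * _ - _ = (lam x + 1) * _
      + -(1 / (2 * (n : ℝ)) * lam x + 1 / (2 * n + 1)) * _ * inner ℝ (X.1 x) (Y.1 x)
    rw [← evalAt_apply]
    change _ = _ + -(1 / (2 * (n : ℝ)) * lam x + 1 / (2 * n + 1))
      * evalAt I x ((S.localCalculus U hS).scal n) * inner ℝ (X.1 x) (Y.1 x)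
    ring
  · ext x
    rw [← evalAt_apply, ← evalAt_apply]
    simp only [map_sub, map_add, map_neg, map_mul, map_natCast, map_ofNat, map_one]
    have e1 : evalAt I x ((1 / (2 * n) : ℝ) • l) = 1 / (2 * n) * evalAt I x l := rfl
    have e2 : evalAt I x (algebraMap ℝ _ (1 / (2 * n + 1))) = (1 / (2 * n + 1) : ℝ) := rfl
    rw [e1, e2]
    field_simp
    ring

/-- Where `κ ≠ -1`, a solution of the critical point equation is equal to `-1`. -/
theorem solution_eq_neg_one (hS : S.IsGeneralizedKappaMu κ μ) (hn : 1 < n)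
    (hE : Module.finrank ℝ E = 2 * n + 1) {lam : M → ℝ}
    (hlam : ContMDiff I 𝓘(ℝ, ℝ) ∞ lam) (h : SatisfiesCPE I lam) {x : M} (hx : κ x + 1 ≠ 0) :
    lam x + 1 = 0 := by
  by_contra hne
  have hn' : (1 : ℝ) < n := by exact_mod_cast hn
  let U : Opens M := ⟨{y | κ y + 1 ≠ 0} ∩ {y | lam y + 1 ≠ 0},
    (isOpen_ne_fun (hS.smooth_kappa.continuous.add continuous_const) continuous_const).inter
      (isOpen_ne_fun (hlam.continuous.add continuous_const) continuous_const)⟩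
  let p : U := ⟨x, hx, hne⟩
  have hs : IsUnit (S.localCalculus U hS).s :=
    isUnit_of_ne_zero fun y ↦ neg_ne_zero.mpr y.2.1
  obtain ⟨u, f, G, hu, hG, hH, hf⟩ := S.exists_solution_data hS hn hE hs hlam h
  have huu : IsUnit u := isUnit_of_ne_zero fun y ↦ by
    rw [hu]; exact y.2.2
  have hP := fun a ↦ S.eq_zero_of_mul_g_P hS (U := U) (zero_lt_one.trans hn) hE (a := a)
  have hμ : (S.localCalculus U hS).μ = 0 :=
    huu.mul_right_eq_zero.mp (hP _ fun X ↦ KappaMuCalculus.u_mul_μ_mul_g_P_eq_zero hs hH X)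
  have h1 := congrArg (evalAt I p) (KappaMuCalculus.u_mul_eq_zero hs (S.D_s_eq_zero hS hn hE hs)
    (zero_lt_one.trans hn) hμ hG hH hf hP)
  simp only [map_sub, map_mul, map_pow, map_natCast, map_ofNat, map_one, map_zero] at h1
  have h2 : (lam x + 1) * (4 * ((n : ℝ) - 1) ^ 2 - 2 - 2 * n * κ x) = 0 := by
    rw [← hu p]; exact h1
  have h3 := S.kappa_le_neg_one hS (zero_lt_one.trans hn) hE x
  have h4 := (mul_eq_zero.mp h2).resolve_left hne
  -- the second factor is positive, as `-2 n κ ≥ 2 n > 2`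
  nlinarith

/-- A solution is equal to `-1` near a point where `h` is not zero, and the equation then says that
the scalar curvature is zero there, whereas it is negative. -/
theorem not_satisfiesCPE (hS : S.IsGeneralizedKappaMu κ μ) (hn : 1 < n)
    (hE : Module.finrank ℝ E = 2 * n + 1) (hh : S.HNeZero)
    {lam : M → ℝ} (hlam : ContMDiff I 𝓘(ℝ, ℝ) ∞ lam) : ¬ SatisfiesCPE I lam := by
  intro h
  obtain ⟨X, hX, x, hx⟩ := hh
  have hn' : (1 : ℝ) < n := by exact_mod_cast hn
  let U : Opens M := ⟨{y | κ y + 1 ≠ 0},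
    isOpen_ne_fun (hS.smooth_kappa.continuous.add continuous_const) continuous_const⟩
  let p : U := ⟨x, fun h0 ↦ hx (S.h_eq_zero hS h0 hX)⟩
  have hs : IsUnit (S.localCalculus U hS).s := isUnit_of_ne_zero fun y ↦ neg_ne_zero.mpr y.2
  obtain ⟨u, f, G, hu, hG, hH, hf⟩ := S.exists_solution_data hS hn hE hs hlam h
  have hu0 : u = 0 := by
    ext y
    rw [hu]
    exact S.solution_eq_neg_one hS hn hE hlam h y.2
  subst hu0
  have hG0 : G = 0 := (S.localCalculus U hS).g_ext _ _ fun Z ↦ by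
    rw [hG, map_zero, map_zero, LinearMap.zero_apply]
  have hf0 := hH (S.localCalculus U hS).ξ (S.localCalculus U hS).ξ
  rw [hG0, map_zero, map_zero, LinearMap.zero_apply, (S.localCalculus U hS).g_ξ_ξ, zero_mul,
    zero_add, mul_one] at hf0
  rw [← hf0] at hf
  have h1 := congrArg (evalAt I p) hf
  simp only [KappaMuCalculus.scal, map_sub, map_add, map_neg, map_mul, map_pow, map_natCast,
    map_ofNat, map_one, map_zero] at h1
  have h2 : 2 * (n : ℝ) * κ x - 4 * n ^ 2 = 0 := by
    change _ = -(2 * (n : ℝ) + 1) * (2 * n * κ x - 4 * n ^ 2) * (0 - 1)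
      - 2 * n * (2 * n * κ x - 4 * n ^ 2) at h1
    linear_combination -h1
  have h3 := S.kappa_le_neg_one hS (zero_lt_one.trans hn) hE x
  -- the scalar curvature in `h2` is negative
  nlinarith

end AlmostContactMetric
end

end

end CPEKenmotsu

end

/-- On a generalized `(κ, μ)`-almost Kenmotsu manifold of dimension `2n + 1`, `n > 1`, on which the
tensor field `h` is not identically zero, no smooth function solves the critical point equation. -/
theorem mainTheorem3 (n : ℕ) (hn : 1 < n)
    {M : Type*} [TopologicalSpace M] [T2Space M]
    [ChartedSpace (EuclideanSpace ℝ (Fin (2 * n + 1))) M]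
    [IsManifold (𝓡 (2 * n + 1)) ∞ M]
    [RiemannianBundle (TangentSpace (𝓡 (2 * n + 1)) : M → Type _)]
    [IsContMDiffRiemannianBundle (𝓡 (2 * n + 1)) ∞ (EuclideanSpace ℝ (Fin (2 * n + 1)))
      (TangentSpace (𝓡 (2 * n + 1)) : M → Type _)]
    (S : CPEKenmotsu.AlmostContactMetric (𝓡 (2 * n + 1)) M) (κ μ : M → ℝ)
    (hS : S.IsGeneralizedKappaMu κ μ) (hh : S.HNeZero) :
    ¬ ∃ lam : M → ℝ, ContMDiff (𝓡 (2 * n + 1)) 𝓘(ℝ, ℝ) ∞ lam ∧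
      CPEKenmotsu.SatisfiesCPE (𝓡 (2 * n + 1)) lam := by
  rintro ⟨lam, hlam, h⟩
  exact S.not_satisfiesCPE hS hn (by simp) hh hlam h
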